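/- **Setting.** Let $\alpha\in[0,\infty)$ and $\lambda>0$, and let $G_\lambda(x)=\frac{e^{-\sqrt\lambda|x|}}{4\pi|x|}$ on $\mathbb R^3$. Let $-\Delta_\alpha$ be the nonnegative self-adjoint point-interaction Hamiltonian on $L^2(\mathbb R^3)$: for any fixed $\mu>0$ (the operator does not depend on the choice of $\mu$) its domain consists of the functions $$g=f+\frac{f(0)}{\alpha+\frac{\sqrt\mu}{4\pi}}\,G_\mu,\qquad f\in H^2(\mathbb R^3),$$ and $(-\Delta_\alpha+\mu)g=(-\Delta+\mu)f$. Its power $(-\Delta_\alpha)^{1/4}$ is defined by the functional calculus. For $f\in H^{1/2}(\mathbb R^3)$ put $$c_f(t)=\int_{\mathbb R^3}G_{\lambda+t}(y)\,\big((-\Delta+\lambda)^{1/4}f\big)(y)\,dy,\qquad h_f(x)=4\sin\tfrac{\pi}{4}\int_0^{\infty}\frac{t^{-1/4}\,c_f(t)}{4\pi\alpha+\sqrt{\lambda+t}}\,G_{\lambda+t}(x)\,dt ,$$ and let $H^{\frac12-}(\mathbb R^3)=\bigcap_{\sigma<1/2}H^\sigma(\mathbb R^3)$, the intersection being taken inside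 $L^2(\mathbb R^3)$. **Proposition (transition case $s=\frac12$).** For every $f\in H^{1/2}(\mathbb R^3)$ the integral defining $h_f(x)$ converges absolutely for all $x\neq0$, and $h_f\in H^{\frac12-}(\mathbb R^3)$. The domain of $(-\Delta_\alpha)^{1/4}$ is $$\mathcal D\big((-\Delta_\alpha)^{1/4}\big)=\{\,f+h_f \;:\; f\in H^{1/2}(\mathbb R^3)\,\}.$$ Moreover, the sum of $H^{1/2}(\mathbb R^3)$ and $\mathrm{span}\{G_\lambda\}$ is direct, and $$H^{1/2}(\mathbb R^3)\dotplus\mathrm{span}\{G_\lambda\}\;\subsetneq\;\mathcal D\big((-\Delta_\alpha)^{1/4}\big)\;\subset\;H^{\frac12-}(\mathbb R^3).$$ -/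

import Mathlib

open MeasureTheory Set

open scoped Laplacian FourierTransform SchwartzMap

noncomputable section

namespace PointInteraction

/-- Three-dimensional Euclidean space. -/
abbrev E3 : Type := EuclideanSpace ℝ (Fin 3)

/-- The complex Hilbert space `L²(ℝ³)`. -/
abbrev L2 : Type := Lp ℂ 2 (volume : Measure E3)

/-! ### Fractional powers of nonnegative self-adjoint operators -/

section Powers

variable {H : Type*} [NormedAddCommGroup H] [InnerProductSpace ℂ H] [CompleteSpace H]

/-- `R` is the bounded operator `(T + 1)⁻¹`, and `0 ≤ R ≤ 1` in the operator order.
Such an `R` exists exactly when `T` is self-adjoint and nonnegative, and it is then unique. -/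
structure IsUnitResolvent (T : H →ₗ.[ℂ] H) (R : H →L[ℂ] H) : Prop where
  nonneg : 0 ≤ R
  le_one : R ≤ 1
  right_inv : ∀ x : H, ∃ hx : R x ∈ T.domain, T ⟨R x, hx⟩ + R x = x
  left_inv : ∀ y : T.domain, R (T y + (y : H)) = (y : H)

open scoped Classical in
/-- The operator `(T + 1)⁻¹` of a nonnegative self-adjoint operator `T`
(by convention `0` if `T` is not of this kind). -/
def unitResolvent (T : H →ₗ.[ℂ] H) : H →L[ℂ] H :=
  if h : ∃ R : H →L[ℂ] H, IsUnitResolvent T R then h.choose else 0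

/-- The graph of `T ^ a`. With `R = (T + 1)⁻¹` one has `T = (1 - R) / R`, and the functional
calculus gives `T ^ a = (R ^ a)⁻¹ (1 - R) ^ a` with its natural domain: `T ^ a g = v` if and only
if `R ^ a v = (1 - R) ^ a g`. Here the powers of the bounded nonnegative operators `R` and `1 - R`
are those of the continuous functional calculus. -/
def powGraph (T : H →ₗ.[ℂ] H) (a : ℝ) : Submodule ℂ (H × H) where
  carrier := {p | (unitResolvent T ^ a) p.2 = ((1 - unitResolvent T) ^ a) p.1}
  add_mem' := by
    intro p q hp hq
    simp only [mem_ofPred_eq, Prod.snd_add, Prod.fst_add, map_add] at hp hq ⊢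
    rw [hp, hq]
  zero_mem' := by simp
  smul_mem' := by
    intro c p hp
    simp only [mem_ofPred_eq, Prod.smul_snd, Prod.smul_fst, map_smul] at hp ⊢
    rw [hp]

/-- The fractional power `T ^ a`, `a ≥ 0`, of a nonnegative self-adjoint operator `T`. -/
def fractionalPower (T : H →ₗ.[ℂ] H) (a : ℝ) : H →ₗ.[ℂ] H :=
  (powGraph T a).toLinearPMap

end Powers

/-! ### Sobolev spaces and powers of the free operator -/

/-- The tempered distribution defined by an `L²` function. -/
abbrev toDist (f : L2) : 𝓢'(E3, ℂ) := Lp.toTemperedDistributionCLM ℂ (volume : Measure E3) 2 f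

/-- The `L²`-functions in the Sobolev space `H^s(ℝ³)` (all of `H^s(ℝ³)` if `s ≥ 0`). -/
def sobolev (s : ℝ) : Submodule ℂ L2 where
  carrier := {f | TemperedDistribution.MemSobolev s 2 (toDist f)}
  add_mem' := by
    intro f g hf hg
    simp only [mem_ofPred_eq, toDist, map_add] at hf hg ⊢
    exact hf.add hg
  zero_mem' := by
    simp only [mem_ofPred_eq, toDist, map_zero]
    exact TemperedDistribution.memSobolev_fun_zero E3 ℂ s 2
  smul_mem' := by
    intro c f hf
    simp only [mem_ofPred_eq, toDist, map_smul] at hf ⊢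
    exact hf.smul c

/-- The space `H^{s-}(ℝ³)`, the intersection of the spaces `H^σ(ℝ³)` with `σ < s`. -/
def sobolevMinus (s : ℝ) : Submodule ℂ L2 := ⨅ σ ∈ Iio s, sobolev σ

open scoped Classical in
/-- The function `(-Δ + lam)^{s/2} f` of `L²(ℝ³)`, for `f` in `H^s(ℝ³)`: the Fourier multiplier with
symbol `(|p|² + lam)^{s/2}`, where `p = 2πξ` because Mathlib's Fourier transform has the kernel
`exp (-2πi x·ξ)` (by convention `0` if `f` is not in `H^s(ℝ³)`). -/
def freePower (lam s : ℝ) (f : L2) : L2 :=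
  if h : ∃ u : L2, toDist u = TemperedDistribution.fourierMultiplierCLM ℂ
      (fun ξ : E3 => (((4 * Real.pi ^ 2 * ‖ξ‖ ^ 2 + lam) ^ (s / 2) : ℝ) : ℂ)) (toDist f)
  then h.choose else 0

/-! ### The Green function -/

/-- `G_lam(x) = exp (-√lam |x|) / (4π|x|)`. -/
def green (lam : ℝ) (x : E3) : ℂ :=
  ((Real.exp (-(Real.sqrt lam * ‖x‖)) / (4 * Real.pi * ‖x‖) : ℝ) : ℂ)

theorem memLp_green {lam : ℝ} (hlam : 0 < lam) : MemLp (green lam) 2 (volume : Measure E3) := by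
  have hmeas : Measurable (green lam) := by
    unfold green
    fun_prop
  rw [memLp_two_iff_integrable_sq_norm hmeas.aestronglyMeasurable]
  have h1 : (fun x : E3 => ‖green lam x‖ ^ 2) = fun x : E3 =>
      (fun r : ℝ => (Real.exp (-(Real.sqrt lam * r)) / (4 * Real.pi * r)) ^ 2) ‖x‖ := by
    funext x
    simp only [green, Complex.norm_real, Real.norm_eq_abs, sq_abs]
  rw [h1, integrable_fun_norm_addHaar (volume : Measure E3)
    (f := fun r : ℝ => (Real.exp (-(Real.sqrt lam * r)) / (4 * Real.pi * r)) ^ 2)]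
  have hs : 0 < 2 * Real.sqrt lam := by
    have := Real.sqrt_pos.2 hlam
    positivity
  have h2 : IntegrableOn (fun r : ℝ => (1 / (4 * Real.pi) ^ 2) *
      Real.exp (-(2 * Real.sqrt lam) * r)) (Ioi 0) :=
    (exp_neg_integrableOn_Ioi 0 hs).const_mul _
  refine h2.congr_fun (fun r hr => ?_) measurableSet_Ioi
  have hr0 : r ≠ 0 := ne_of_gt hr
  have hexp : Real.exp (-(2 * Real.sqrt lam) * r) = Real.exp (-(Real.sqrt lam * r)) ^ 2 := by
    rw [← Real.exp_nat_mul]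
    congr 1
    push_cast
    ring
  simp only [hexp, finrank_euclideanSpace, Fintype.card_fin, smul_eq_mul]
  have hpi := Real.pi_ne_zero
  field_simp

/-- `G_lam` as an element of `L²(ℝ³)`. -/
def greenL2 {lam : ℝ} (hlam : 0 < lam) : L2 := (memLp_green hlam).toLp (green lam)

/-! ### The point interaction Hamiltonian -/

/-- The graph of `-Δ_α`, written with the reference value `μ > 0`: the pairs `(g, v)` with
`g = f + f(0) / (α + √μ / 4π) G_μ` and `v + μ g = (-Δ + μ) f` for some `f` in `H²(ℝ³)`.
Here `φ` is the continuous representative of `f`. -/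
def hamiltonianGraph (α μ : ℝ) : Submodule ℂ (L2 × L2) where
  carrier := {p | ∃ f ∈ sobolev 2, ∃ φ : E3 → ℂ, Continuous φ ∧ (f : E3 → ℂ) =ᵐ[volume] φ ∧
    ((p.1 : E3 → ℂ) =ᵐ[volume]
      fun x => φ x + φ 0 / ((α + Real.sqrt μ / (4 * Real.pi) : ℝ) : ℂ) * green μ x) ∧
    toDist (p.2 + (μ : ℂ) • p.1) = -Δ (toDist f) + (μ : ℂ) • toDist f}
  add_mem' := by
    rintro p q ⟨f, hf, φ, hφ, hfφ, hp, hpd⟩ ⟨k, hk, ψ, hψ, hkψ, hq, hqd⟩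
    refine ⟨f + k, add_mem hf hk, φ + ψ, hφ.add hψ, ?_, ?_, ?_⟩
    · exact (Lp.coeFn_add f k).trans (hfφ.add hkψ)
    · refine (Lp.coeFn_add p.1 q.1).trans ?_
      filter_upwards [hp, hq] with x hx hy
      simp only [Pi.add_apply, hx, hy]
      ring
    · have e : (p + q).2 + (μ : ℂ) • (p + q).1 =
          (p.2 + (μ : ℂ) • p.1) + (q.2 + (μ : ℂ) • q.1) := by
        simp only [Prod.snd_add, Prod.fst_add, smul_add]
        abel
      have l := (TemperedDistribution.laplacianCLM_apply (E := E3) (F := ℂ))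
      rw [e]
      simp only [toDist, map_add] at hpd hqd ⊢
      rw [hpd, hqd, ← l, ← l, ← l]
      simp only [map_add, smul_add, neg_add]
      abel
  zero_mem' := by
    refine ⟨0, zero_mem _, 0, continuous_zero, Lp.coeFn_zero _ _ _, ?_, ?_⟩
    · refine (Lp.coeFn_zero ℂ 2 (volume : Measure E3)).trans ?_
      filter_upwards with x
      simp
    · have l := (TemperedDistribution.laplacianCLM_apply (E := E3) (F := ℂ))
      have e : (0 : L2 × L2).2 + (μ : ℂ) • (0 : L2 × L2).1 = 0 := by simp
      have z : toDist 0 = 0 := map_zero _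
      have w : (μ : ℂ) • toDist 0 = 0 := by
        unfold toDist
        rw [← map_smul, smul_zero, map_zero]
      rw [e, w, z, ← l, map_zero, neg_zero, zero_add]
  smul_mem' := by
    rintro c p ⟨f, hf, φ, hφ, hfφ, hp, hpd⟩
    refine ⟨c • f, Submodule.smul_mem _ c hf, c • φ, hφ.const_smul c, ?_, ?_, ?_⟩
    · exact (Lp.coeFn_smul c f).trans (hfφ.const_smul c)
    · refine (Lp.coeFn_smul c p.1).trans ?_
      filter_upwards [hp] with x hx
      simp only [Pi.smul_apply, hx, smul_eq_mul]
      ring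
    · have e : (c • p).2 + (μ : ℂ) • (c • p).1 = c • (p.2 + (μ : ℂ) • p.1) := by
        simp only [Prod.smul_snd, Prod.smul_fst, smul_add, smul_comm c (μ : ℂ)]
      have l := (TemperedDistribution.laplacianCLM_apply (E := E3) (F := ℂ))
      rw [e]
      simp only [toDist, map_smul] at hpd ⊢
      rw [hpd, ← l, ← l]
      simp only [map_smul, smul_add, smul_neg, smul_comm c (μ : ℂ)]

/-- The operator `-Δ_α` on `L²(ℝ³)`, for a real `α`; it does not depend on the choice of `μ > 0`. -/
def hamiltonian (α μ : ℝ) : L2 →ₗ.[ℂ] L2 := (hamiltonianGraph α μ).toLinearPMap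

/-! ### The singular component -/

/-- `c_f(t) = ∫ G_{lam+t}(y) ((-Δ + lam)^{s/2} f)(y) dy`. -/
def coeff (lam s : ℝ) (f : L2) (t : ℝ) : ℂ :=
  ∫ y : E3, green (lam + t) y * (freePower lam s f : E3 → ℂ) y

/-- The function of `t` whose integral over `(0, ∞)` defines `h_f(x)`, up to a constant. -/
def singularIntegrand (α lam s : ℝ) (f : L2) (x : E3) (t : ℝ) : ℂ :=
  ((t ^ (-(s / 2)) : ℝ) : ℂ) * coeff lam s f t
    / ((4 * Real.pi * α + Real.sqrt (lam + t) : ℝ) : ℂ) * green (lam + t) x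

/-- `h_f(x) = 4 sin(sπ/2) ∫₀^∞ t^{-s/2} c_f(t) / (4πα + √(lam+t)) G_{lam+t}(x) dt`. -/
def singularPart (α lam s : ℝ) (f : L2) (x : E3) : ℂ :=
  ((4 * Real.sin (s * Real.pi / 2) : ℝ) : ℂ) * ∫ t in Ioi (0 : ℝ), singularIntegrand α lam s f x t

end PointInteraction

end

noncomputable section

namespace PointInteraction

/-! ### Roots of positive operators and range inclusions. -/

section Powers

variable {H : Type*} [NormedAddCommGroup H] [InnerProductSpace ℂ H] [CompleteSpace H]

open scoped InnerProductSpace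

/-! Write K_a for the free resolvent (-Δ + a)⁻¹ and R_a for (-Δ_α + a)⁻¹. Krein's formula R_a = K_a
+ β_a ⟨G_a, ·⟩ G_a, with β_a = (α + √a/4π)⁻¹, is what the definition of the Hamiltonian says once
f(0) is recognized as an inner product with G_a (`mem_hamiltonianGraph_iff`). These operators
satisfy the resolvent identity because ⟨G_a, G_b⟩ = 1/(4π(√a + √b)).

The domain of the power 1/4 is the range of R_1^{1/4} (`domain_fractionalPower`). Resolvents at two
points are bounded by multiples of each other, and operator monotonicity of the square root with
Douglas factorization turns this into equality of the ranges of the fourth roots, so 1 may be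
replaced by λ. Balakrishnan's formula expresses √2 π R_λ^{1/4} and √2 π K_λ^{1/4} as integrals of
t^{-1/4} times the resolvents at λ + t (`quarter_eq_integral`). In the difference only the rank-one
terms survive. With f = K_λ^{1/4} u, which runs through H^{1/2}, this difference applied to u is h_f
(`singularVec_ae_eq`).

For σ < 1/2, the H^σ norm of G_{λ+t} decays fast enough in t for the integral to stay in H^σ
(`singularVec_mem_sobolev`). At σ = 1/2 the function G_λ itself is lost, by a logarithmic divergence
(`greenVec_notMem_range`), so the sum is direct.

G_λ lies in the domain since R_λ dominates the rank-one term. The inclusion is strict by a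
closed-range argument (`not_range_le_sup_span`). If H^{1/2} and G_λ exhausted the domain, then
H^{1/2} would be closed of codimension one in it for the graph norm. But the vectors G_b are bounded
in that norm and tend weakly to 0 as b → ∞, while G_λ - G_b is in H^{1/2}. Hence G_λ would be a weak
limit of elements of H^{1/2} and belong to it. -/

theorem denseRange_of_isSelfAdjoint_of_injective {B : H →L[ℂ] H} (hB : IsSelfAdjoint B)
    (hinj : Function.Injective B) : DenseRange B := by
  have h := B.orthogonal_range
  rw [hB.adjoint_eq, LinearMap.ker_eq_bot.2 hinj] at h
  have h2 := (Submodule.topologicalClosure_eq_top_iff (K := B.range)).2 h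
  have := (Submodule.dense_iff_topologicalClosure_eq_top).2 h2
  simpa [DenseRange] using! this

/-- Douglas factorization: `‖A x‖ ≤ ‖B x‖` implies that the adjoint of `A` factors through `B`. -/
theorem exists_factor_of_norm_le {E : Type*} [NormedAddCommGroup E] [InnerProductSpace ℂ E]
    [CompleteSpace E] {A : H →L[ℂ] E} {B : H →L[ℂ] H}
    (hB : IsSelfAdjoint B) (hinj : Function.Injective B) (h : ∀ x, ‖A x‖ ≤ ‖B x‖) :
    ∃ C : E →L[ℂ] H, ‖C‖ ≤ 1 ∧ ContinuousLinearMap.adjoint A = B ∘L C := by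
  have hd := denseRange_of_isSelfAdjoint_of_injective hB hinj
  have h' : ∀ x, ‖(A : H →ₗ[ℂ] E) x‖ ≤ 1 * ‖(B : H →ₗ[ℂ] H) x‖ := by simpa using h
  -- The map B x ↦ A x is a contraction on the dense range of B; `C0` is its continuous extension.
  let C0 : H →L[ℂ] E := (A : H →ₗ[ℂ] E).extendOfNorm (B : H →ₗ[ℂ] H)
  have hC0 : A = C0 ∘L B := by
    ext x
    exact (LinearMap.extendOfNorm_eq hd ⟨1, h'⟩ x).symm
  refine ⟨ContinuousLinearMap.adjoint C0, ?_, ?_⟩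
  · rw [LinearIsometryEquiv.norm_map]
    exact LinearMap.opNorm_extendOfNorm_le hd zero_le_one h'
  · rw [hC0, ContinuousLinearMap.adjoint_comp, hB.adjoint_eq]

omit [CompleteSpace H] in
theorem re_inner_le_of_le {A B : H →L[ℂ] H} (h : A ≤ B) (x : H) :
    (⟪A x, x⟫_ℂ).re ≤ (⟪B x, x⟫_ℂ).re := by
  have := ((ContinuousLinearMap.le_def A B).1 h).re_inner_nonneg_left x
  simp only [sub_apply, inner_sub_left, map_sub] at this
  simpa using this

theorem norm_sq_eq_re_inner {A B : H →L[ℂ] H} (hB : IsSelfAdjoint B) (h : B * B = A) (x : H) :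
    ‖B x‖ ^ 2 = (⟪A x, x⟫_ℂ).re := by
  rw [← h, mul_apply_eq_comp, ← ContinuousLinearMap.adjoint_inner_right, hB.adjoint_eq,
    inner_self_eq_norm_sq_to_K]
  norm_cast

theorem sqrtP_mul_self {A : H →L[ℂ] H} (hA : 0 ≤ A) : A ^ (1 / 2 : ℝ) * A ^ (1 / 2 : ℝ) = A := by
  rw [← CFC.sqrt_eq_rpow, CFC.sqrt_mul_sqrt_self A]

theorem quarter_rpow {A : H →L[ℂ] H} (hA : 0 ≤ A) :
    A ^ (1 / 4 : ℝ) = (A ^ (1 / 2 : ℝ)) ^ (1 / 2 : ℝ) := by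
  rw [CFC.rpow_rpow_of_exponent_nonneg A _ _ (by norm_num) (by norm_num)]
  norm_num

theorem quarter_mul_self {A : H →L[ℂ] H} (hA : 0 ≤ A) :
    A ^ (1 / 4 : ℝ) * A ^ (1 / 4 : ℝ) = A ^ (1 / 2 : ℝ) := by
  have h := sqrtP_mul_self (A := A ^ (1 / 2 : ℝ)) CFC.rpow_nonneg
  rwa [← quarter_rpow hA] at h

omit [CompleteSpace H] in
theorem injective_of_mul_self {A B : H →L[ℂ] H} (h : B * B = A) (hA : Function.Injective A) :
    Function.Injective B := by
  have : (A : H → H) = B ∘ B := by rw [← h]; rfl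
  rw [this] at hA
  exact hA.of_comp

theorem injective_half {A : H →L[ℂ] H} (hA : 0 ≤ A) (hi : Function.Injective A) :
    Function.Injective (A ^ (1 / 2 : ℝ) : H →L[ℂ] H) :=
  injective_of_mul_self (sqrtP_mul_self hA) hi

theorem injective_quarter {A : H →L[ℂ] H} (hA : 0 ≤ A) (hi : Function.Injective A) :
    Function.Injective (A ^ (1 / 4 : ℝ) : H →L[ℂ] H) :=
  injective_of_mul_self (quarter_mul_self hA) (injective_half hA hi)

theorem isSelfAdjoint_rpow (A : H →L[ℂ] H) (s : ℝ) : IsSelfAdjoint (A ^ s) :=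
  IsSelfAdjoint.of_nonneg CFC.rpow_nonneg

/-- If `0 ≤ A ≤ B`, then `A ^ (1 / 4)` factors through `B ^ (1 / 4)`. -/
theorem exists_factor_quarter {A B : H →L[ℂ] H} (hA : 0 ≤ A) (hAB : A ≤ B)
    (hi : Function.Injective B) :
    ∃ C : H →L[ℂ] H, A ^ (1 / 4 : ℝ) = B ^ (1 / 4 : ℝ) * C := by
  have hB := hA.trans hAB
  -- Löwner–Heinz. Since ‖A^{1/4} x‖² = ⟨A^{1/2} x, x⟩, this is the norm comparison that Douglas
  -- factorization needs.
  have h1 : A ^ (1 / 2 : ℝ) ≤ B ^ (1 / 2 : ℝ) :=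
    CFC.rpow_le_rpow ⟨by norm_num, by norm_num⟩ hAB
  obtain ⟨C, -, hC⟩ := exists_factor_of_norm_le (A := A ^ (1 / 4 : ℝ))
    (isSelfAdjoint_rpow B (1 / 4)) (injective_quarter hB hi) (fun x => by
      rw [← sq_le_sq₀ (norm_nonneg _) (norm_nonneg _),
        norm_sq_eq_re_inner (isSelfAdjoint_rpow A _) (quarter_mul_self hA),
        norm_sq_eq_re_inner (isSelfAdjoint_rpow B _) (quarter_mul_self hB)]
      exact re_inner_le_of_le h1 x)
  refine ⟨C, ?_⟩
  rw [(isSelfAdjoint_rpow A _).adjoint_eq] at hC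
  exact hC

theorem range_quarter_le {A B : H →L[ℂ] H} (hA : 0 ≤ A) (hAB : A ≤ B)
    (hi : Function.Injective B) :
    (A ^ (1 / 4 : ℝ) : H →L[ℂ] H).range ≤ (B ^ (1 / 4 : ℝ) : H →L[ℂ] H).range := by
  obtain ⟨C, hC⟩ := exists_factor_quarter hA hAB hi
  rintro _ ⟨x, rfl⟩
  exact ⟨C x, by rw [hC]; rfl⟩

theorem range_quarter_smul_le {A : H →L[ℂ] H} (hA : 0 ≤ A) {c : ℝ} (hc : 0 < c) :
    ((c • A) ^ (1 / 4 : ℝ) : H →L[ℂ] H).range ≤ (A ^ (1 / 4 : ℝ) : H →L[ℂ] H).range := by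
  have e : (c • A) ^ (1 / 4 : ℝ) = (c ^ (1 / 4 : ℝ)) • A ^ (1 / 4 : ℝ) := by
    have hcA : 0 ≤ c • A := smul_nonneg hc.le hA
    have h0 : 0 ≤ (c ^ (1 / 4 : ℝ)) • A ^ (1 / 4 : ℝ) :=
      smul_nonneg (by positivity) CFC.rpow_nonneg
    have h0' : 0 ≤ (c ^ (1 / 2 : ℝ)) • A ^ (1 / 2 : ℝ) :=
      smul_nonneg (by positivity) CFC.rpow_nonneg
    rw [quarter_rpow hcA, ← CFC.sqrt_eq_rpow, ← CFC.sqrt_eq_rpow]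
    refine CFC.sqrt_unique ?_ h0
    symm
    refine CFC.sqrt_unique ?_ (by
      rw [smul_mul_smul_comm, quarter_mul_self hA, ← Real.rpow_add hc]; norm_num; exact h0')
    simp only [smul_mul_smul_comm, quarter_mul_self hA, sqrtP_mul_self hA, ← Real.rpow_add hc]
    norm_num
  rw [e]
  rintro _ ⟨x, rfl⟩
  exact ⟨(c ^ (1 / 4 : ℝ)) • x, by simp⟩

/-- If `A` dominates `G ⊗ G`, then `G` is in the range of `A ^ (1 / 2)`. -/
theorem exists_half_eq_of_rankOne_le {A : H →L[ℂ] H} (hA : 0 ≤ A)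
    (hi : Function.Injective A) (G : H) {b : ℝ} (hb : 0 < b)
    (h : b • InnerProductSpace.rankOne ℂ G G ≤ A) :
    ∃ y : H, (A ^ (1 / 2 : ℝ) : H →L[ℂ] H) y = G ∧ ‖y‖ ^ 2 ≤ 1 / b := by
  -- Here ‖L x‖² = b |⟨G, x⟩|² ≤ ⟨A x, x⟩, and the adjoint of `L` sends 1 to √b G. The preimage of G
  -- is thus `C 1` divided by √b, and ‖C‖ ≤ 1 gives the bound 1/b.
  let L : H →L[ℂ] ℂ := innerSL ℂ (((Real.sqrt b : ℝ) : ℂ) • G)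
  obtain ⟨C, hC1, hC⟩ := exists_factor_of_norm_le (A := L)
    (isSelfAdjoint_rpow A (1 / 2)) (injective_half hA hi) (fun x => by
      rw [← sq_le_sq₀ (norm_nonneg _) (norm_nonneg _),
        norm_sq_eq_re_inner (isSelfAdjoint_rpow A _) (sqrtP_mul_self hA)]
      refine le_trans (le_of_eq ?_) (re_inner_le_of_le h x)
      have : ⟪(b • InnerProductSpace.rankOne ℂ G G : H →L[ℂ] H) x, x⟫_ℂ =
          ((b * ‖⟪G, x⟫_ℂ‖ ^ 2 : ℝ) : ℂ) := by
        rw [smul_apply, InnerProductSpace.rankOne_apply,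
          ← Complex.coe_smul, inner_smul_left, inner_smul_left]
        rw [Complex.conj_ofReal, Complex.conj_mul']
        push_cast; ring
      rw [this, Complex.ofReal_re]
      simp only [L, innerSL_apply_apply, inner_smul_left, norm_mul, Complex.conj_ofReal,
        Complex.norm_real, mul_pow, Real.norm_eq_abs, sq_abs, Real.sq_sqrt hb.le])
  have hs : (0 : ℝ) < Real.sqrt b := Real.sqrt_pos.2 hb
  have h1 : (A ^ (1 / 2 : ℝ) : H →L[ℂ] H) (C 1) = ((Real.sqrt b : ℝ) : ℂ) • G := by
    have := congrArg (fun T : ℂ →L[ℂ] H => T 1) hC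
    simp only [L, ContinuousLinearMap.adjoint_innerSL_apply, ContinuousLinearMap.comp_apply] at this
    rw [← this]; simp
  refine ⟨(((Real.sqrt b : ℝ) : ℂ)⁻¹) • C 1, ?_, ?_⟩
  · rw [map_smul, h1, smul_smul, inv_mul_cancel₀ (by exact_mod_cast hs.ne'), one_smul]
  · rw [norm_smul, mul_pow, norm_inv, Complex.norm_real, Real.norm_eq_abs, inv_pow, sq_abs,
      Real.sq_sqrt hb.le]
    have : ‖C 1‖ ≤ 1 := by
      calc ‖C 1‖ ≤ ‖C‖ * ‖(1 : ℂ)‖ := C.le_opNorm 1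
        _ ≤ 1 := by simpa using hC1
    rw [one_div]
    have h2 : ‖C 1‖ ^ 2 ≤ 1 := pow_le_one₀ (norm_nonneg _) this
    exact mul_le_of_le_one_right (by positivity) h2

/-! ### The domain of a fractional power -/

omit [CompleteSpace H] in
theorem IsUnitResolvent.unique {T : H →ₗ.[ℂ] H} {R R' : H →L[ℂ] H} (h : IsUnitResolvent T R)
    (h' : IsUnitResolvent T R') : R = R' := by
  ext x
  obtain ⟨hx, e⟩ := h.right_inv x
  have := h'.left_inv ⟨R x, hx⟩
  simp only [e] at this
  exact this.symm

omit [CompleteSpace H] in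
theorem unitResolvent_eq {T : H →ₗ.[ℂ] H} {R : H →L[ℂ] H} (h : IsUnitResolvent T R) :
    unitResolvent T = R := by
  have h' : ∃ R : H →L[ℂ] H, IsUnitResolvent T R := ⟨R, h⟩
  rw [unitResolvent, dif_pos h']
  exact h'.choose_spec.unique h

open scoped Pointwise in
theorem spectrum_subset_of_nonneg_le_one {R : H →L[ℂ] H} (h0 : 0 ≤ R) (h1 : R ≤ 1) {x : ℝ}
    (hx : x ∈ spectrum ℝ R) : 0 ≤ x ∧ x ≤ 1 := by
  refine ⟨spectrum_nonneg_of_nonneg h0 hx, ?_⟩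
  have h2 : 0 ≤ 1 - R := sub_nonneg.2 h1
  have h3 : 1 - x ∈ spectrum ℝ (1 - R) := by
    have e : spectrum ℝ (1 - R) = ({(1 : ℝ)} : Set ℝ) - spectrum ℝ R := by
      rw [spectrum.singleton_sub_eq, map_one]
    rw [e]
    exact Set.sub_mem_sub (Set.mem_singleton _) hx
  linarith [spectrum_nonneg_of_nonneg h2 h3]

/-- The functions x^s and (1 - x)^s have no common zero on [0, 1], so there are continuous a, b on
the spectrum with x^s a + b (1 - x)^s = 1. If (g, v) is in the graph, i.e. R^s v = (1 - R)^s g, this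
gives g = R^s (a(R) g + b(R) v). Conversely R^s w is paired with (1 - R)^s w. -/
theorem domain_fractionalPower {T : H →ₗ.[ℂ] H} {R : H →L[ℂ] H} (h : IsUnitResolvent T R)
    {s : ℝ} (hs : 0 < s) :
    (fractionalPower T s).domain = (R ^ s : H →L[ℂ] H).range := by
  have hR := unitResolvent_eq h
  have hsa : IsSelfAdjoint R := IsSelfAdjoint.of_nonneg h.nonneg
  have h1R : 0 ≤ 1 - R := sub_nonneg.2 h.le_one
  have hspec := fun x (hx : x ∈ spectrum ℝ R) =>
    spectrum_subset_of_nonneg_le_one h.nonneg h.le_one hx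
  have e1 : R ^ s = cfc (fun x : ℝ => x ^ s) R := CFC.rpow_eq_cfc_real h.nonneg
  have e2 : (1 - R) ^ s = cfc (fun x : ℝ => (1 - x) ^ s) R := by
    rw [CFC.rpow_eq_cfc_real h1R]
    have : 1 - R = cfc (fun x : ℝ => 1 - x) R := by
      rw [cfc_sub (fun _ : ℝ => (1 : ℝ)) (fun x => x) R, cfc_const_one ℝ R, cfc_id' ℝ R]
    conv_lhs => rw [this]
    rw [← cfc_comp' (fun x : ℝ => x ^ s) (fun x : ℝ => 1 - x) R
      (Real.continuous_rpow_const hs.le).continuousOn]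
  have c1 : Continuous fun x : ℝ => x ^ s := Real.continuous_rpow_const hs.le
  have c2 : Continuous fun x : ℝ => (1 - x) ^ s := c1.comp (by fun_prop)
  have hpos : ∀ x ∈ spectrum ℝ R, 0 < (x ^ s) ^ 2 + ((1 - x) ^ s) ^ 2 := by
    intro x hx
    obtain ⟨h0, h1⟩ := hspec x hx
    rcases eq_or_lt_of_le h0 with h | h
    · rw [← h]; simp; positivity
    · have := Real.rpow_pos_of_pos h s
      positivity
  let a : ℝ → ℝ := fun x => x ^ s / ((x ^ s) ^ 2 + ((1 - x) ^ s) ^ 2)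
  let b : ℝ → ℝ := fun x => (1 - x) ^ s / ((x ^ s) ^ 2 + ((1 - x) ^ s) ^ 2)
  have ca : ContinuousOn a (spectrum ℝ R) :=
    c1.continuousOn.div (by fun_prop) (fun x hx => (hpos x hx).ne')
  have cb : ContinuousOn b (spectrum ℝ R) :=
    c2.continuousOn.div (by fun_prop) (fun x hx => (hpos x hx).ne')
  have key : R ^ s * cfc a R + cfc b R * (1 - R) ^ s = 1 := by
    have i1 : ContinuousOn (fun x => x ^ s * a x) (spectrum ℝ R) := c1.continuousOn.mul ca
    have i2 : ContinuousOn (fun x => b x * (1 - x) ^ s) (spectrum ℝ R) := cb.mul c2.continuousOn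
    rw [e1, e2, ← cfc_mul _ _ R c1.continuousOn ca, ← cfc_mul _ _ R cb c2.continuousOn,
      ← cfc_add R _ _ i1 i2, ← cfc_const_one ℝ R]
    refine cfc_congr fun x hx => ?_
    have := (hpos x hx).ne'
    simp only [a, b]
    field_simp
  have comm : R ^ s * (1 - R) ^ s = (1 - R) ^ s * R ^ s := by
    rw [e1, e2]
    exact cfc_commute_cfc _ _ R
  have comm2 : cfc b R * R ^ s = R ^ s * cfc b R := by
    rw [e1]
    exact cfc_commute_cfc _ _ R
  ext g
  rw [fractionalPower, Submodule.toLinearPMap_domain]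
  constructor
  · rintro ⟨p, hp, rfl⟩
    have hp' : (R ^ s) p.2 = ((1 - R) ^ s) p.1 := by
      have := hp
      simp only [powGraph, hR] at this
      exact this
    refine ⟨cfc a R p.1 + cfc b R p.2, ?_⟩
    have k := congrArg (fun A : H →L[ℂ] H => A p.1) key
    have k2 := congrArg (fun A : H →L[ℂ] H => A p.2) comm2
    simp only [add_apply, mul_apply_eq_comp,
      one_apply_eq_self] at k k2
    change (R ^ s) (cfc a R p.1 + cfc b R p.2) = p.1
    rw [map_add, ← k2, hp', k]
  · rintro ⟨w, rfl⟩
    refine ⟨((R ^ s) w, ((1 - R) ^ s) w), ?_, rfl⟩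
    have : (R ^ s) (((1 - R) ^ s) w) = ((1 - R) ^ s) ((R ^ s) w) :=
      congrArg (fun A : H →L[ℂ] H => A w) comm
    simp only [powGraph, hR]
    exact this

end Powers

/-! ### The integral of `t ^ (-1/4) / (1 + t)` -/

/-- The substitution t = v⁴ turns t^{-1/4}/(1 + t) into this integrand. The primitive comes from
partial fractions for 1 + v⁴ = (v² + √2 v + 1)(v² - √2 v + 1); it vanishes at 0, and at infinity the
logarithms cancel and each arctangent contributes π/2. -/
theorem hasDerivAt_quarticPrimitive (v : ℝ) :
    HasDerivAt (fun v : ℝ => (Real.log (v ^ 2 - √2 * v + 1) - Real.log (v ^ 2 + √2 * v + 1)) / √2 +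
      √2 * (Real.arctan (√2 * v + 1) + Real.arctan (√2 * v - 1)))
      (4 * v ^ 2 / (1 + v ^ 4)) v := by
  have h2 : √2 ^ 2 = 2 := Real.sq_sqrt (by norm_num)
  have hp : 0 < √2 := by positivity
  have n1 : 0 < v ^ 2 - √2 * v + 1 := by nlinarith [sq_nonneg (v - √2 / 2)]
  have n2 : 0 < v ^ 2 + √2 * v + 1 := by nlinarith [sq_nonneg (v + √2 / 2)]
  have d1 : HasDerivAt (fun v : ℝ => v ^ 2 - √2 * v + 1) (2 * v - √2) v := by
    simpa using (((hasDerivAt_pow 2 v).sub ((hasDerivAt_id v).const_mul √2)).add_const 1)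
  have d2 : HasDerivAt (fun v : ℝ => v ^ 2 + √2 * v + 1) (2 * v + √2) v := by
    simpa using (((hasDerivAt_pow 2 v).add ((hasDerivAt_id v).const_mul √2)).add_const 1)
  have d3 : HasDerivAt (fun v : ℝ => √2 * v + 1) √2 v := by
    simpa using ((hasDerivAt_id v).const_mul √2).add_const 1
  have d4 : HasDerivAt (fun v : ℝ => √2 * v - 1) √2 v := by
    simpa using ((hasDerivAt_id v).const_mul √2).sub_const 1
  have := (((d1.log n1.ne').sub (d2.log n2.ne')).div_const √2).add
    ((d3.arctan.add d4.arctan).const_mul √2)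
  convert! this using 1
  have m1 : 1 + (√2 * v + 1) ^ 2 = 2 * (v ^ 2 + √2 * v + 1) := by linear_combination v ^ 2 * h2
  have m2 : 1 + (√2 * v - 1) ^ 2 = 2 * (v ^ 2 - √2 * v + 1) := by linear_combination v ^ 2 * h2
  have m3 : 1 + v ^ 4 = (v ^ 2 + √2 * v + 1) * (v ^ 2 - √2 * v + 1) := by
    linear_combination v ^ 2 * h2
  have hA : v ^ 2 + √2 * v + 1 ≠ 0 := n2.ne'
  have hB : v ^ 2 - √2 * v + 1 ≠ 0 := n1.ne'
  have k1 : (2 * v - √2) / (v ^ 2 - √2 * v + 1) - (2 * v + √2) / (v ^ 2 + √2 * v + 1) =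
      √2 * ((2 * v ^ 2 - 2) / ((v ^ 2 + √2 * v + 1) * (v ^ 2 - √2 * v + 1))) := by
    rw [div_sub_div _ _ hB hA, mul_comm (v ^ 2 + √2 * v + 1), ← mul_div_assoc]
    congr 1
    ring
  have k2 : √2 * (1 / (2 * (v ^ 2 + √2 * v + 1)) * √2 + 1 / (2 * (v ^ 2 - √2 * v + 1)) * √2) =
      (2 * v ^ 2 + 2) / ((v ^ 2 + √2 * v + 1) * (v ^ 2 - √2 * v + 1)) := by
    rw [← add_mul, mul_comm, mul_assoc, ← sq, h2,
      div_add_div _ _ (mul_ne_zero two_ne_zero hA) (mul_ne_zero two_ne_zero hB),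
      div_mul_eq_mul_div, div_eq_div_iff (by positivity) (by positivity)]
    ring
  rw [m1, m2, m3, k1, k2, mul_div_cancel_left₀ _ hp.ne', ← add_div]
  congr 1
  ring

theorem tendsto_quarticPrimitive :
    Filter.Tendsto (fun v : ℝ =>
      (Real.log (v ^ 2 - √2 * v + 1) - Real.log (v ^ 2 + √2 * v + 1)) / √2 +
      √2 * (Real.arctan (√2 * v + 1) + Real.arctan (√2 * v - 1))) Filter.atTop
      (nhds (√2 * Real.pi)) := by
  have h2 : √2 ^ 2 = 2 := Real.sq_sqrt (by norm_num)
  have hp : 0 < √2 := by positivity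
  have hinv : Filter.Tendsto (fun v : ℝ => v⁻¹) Filter.atTop (nhds 0) := tendsto_inv_atTop_zero
  have hr : Filter.Tendsto (fun v : ℝ => Real.log ((1 - √2 * v⁻¹ + v⁻¹ ^ 2) /
      (1 + √2 * v⁻¹ + v⁻¹ ^ 2))) Filter.atTop (nhds 0) := by
    have h : ContinuousAt (fun w : ℝ => Real.log ((1 - √2 * w + w ^ 2) / (1 + √2 * w + w ^ 2))) 0 := by
      refine ContinuousAt.log (ContinuousAt.div (by fun_prop) (by fun_prop) (by simp)) (by simp)
    have := h.tendsto.comp hinv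
    simpa [Function.comp_def] using this
  have hl : Filter.Tendsto (fun v : ℝ =>
      (Real.log (v ^ 2 - √2 * v + 1) - Real.log (v ^ 2 + √2 * v + 1))) Filter.atTop (nhds 0) := by
    refine hr.congr' ?_
    filter_upwards [Filter.eventually_gt_atTop 0] with v hv
    have n1 : 0 < v ^ 2 - √2 * v + 1 := by nlinarith [sq_nonneg (v - √2 / 2)]
    have n2 : 0 < v ^ 2 + √2 * v + 1 := by nlinarith [sq_nonneg (v + √2 / 2)]
    rw [← Real.log_div n1.ne' n2.ne']
    congr 1
    field_simp
  have t1 : Filter.Tendsto (fun v : ℝ => √2 * v + 1) Filter.atTop Filter.atTop :=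
    Filter.tendsto_atTop_add_const_right _ _ (Filter.tendsto_id.const_mul_atTop hp)
  have t2 : Filter.Tendsto (fun v : ℝ => √2 * v - 1) Filter.atTop Filter.atTop :=
    Filter.tendsto_atTop_add_const_right _ (-1) (Filter.tendsto_id.const_mul_atTop hp)
  have a := (Real.tendsto_arctan_atTop.mono_right nhdsWithin_le_nhds)
  have := (hl.div_const √2).add (((a.comp t1).add (a.comp t2)).const_mul √2)
  convert! this using 2
  ring

theorem integrableOn_integral_quartic :
    IntegrableOn (fun v : ℝ => 4 * v ^ 2 / (1 + v ^ 4)) (Ioi 0) ∧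
    ∫ v in Ioi (0 : ℝ), 4 * v ^ 2 / (1 + v ^ 4) = √2 * Real.pi := by
  have hn : ∀ v ∈ Ioi (0 : ℝ), 0 ≤ 4 * v ^ 2 / (1 + v ^ 4) := fun v _ => by positivity
  refine ⟨integrableOn_Ioi_deriv_of_nonneg' (fun v _ => hasDerivAt_quarticPrimitive v) hn
    tendsto_quarticPrimitive, ?_⟩
  rw [integral_Ioi_of_hasDerivAt_of_nonneg' (fun v _ => hasDerivAt_quarticPrimitive v) hn
    tendsto_quarticPrimitive]
  simp

theorem quartic_subst {v : ℝ} (hv : v ∈ Ioi (0 : ℝ)) :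
    (|(4 : ℝ)| * v ^ ((4 : ℝ) - 1)) • ((fun t : ℝ => t ^ (-(1 / 4) : ℝ) / (1 + t)) (v ^ (4 : ℝ))) =
      4 * v ^ 2 / (1 + v ^ 4) := by
  have hv0 : 0 < v := hv
  have e1 : v ^ ((4 : ℝ) - 1) = v ^ 3 := by rw [← Real.rpow_natCast]; norm_num
  have e2 : (v ^ (4 : ℝ)) ^ (-(1 / 4) : ℝ) = v⁻¹ := by
    rw [← Real.rpow_mul hv0.le, ← Real.rpow_neg_one]; norm_num
  have e3 : v ^ (4 : ℝ) = v ^ 4 := by rw [← Real.rpow_natCast]; norm_num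
  simp only [e1, e2, smul_eq_mul]
  rw [e3]
  have := hv0.ne'
  rw [abs_of_pos (by norm_num)]
  field_simp

theorem integrableOn_rpow_div_one_add :
    IntegrableOn (fun t : ℝ => t ^ (-(1 / 4) : ℝ) / (1 + t)) (Ioi 0) := by
  rw [← integrableOn_Ioi_comp_rpow_iff _ (show (4 : ℝ) ≠ 0 by norm_num)]
  exact integrableOn_integral_quartic.1.congr_fun (fun v hv => (quartic_subst hv).symm)
    measurableSet_Ioi

theorem integral_rpow_div_one_add :
    ∫ t in Ioi (0 : ℝ), t ^ (-(1 / 4) : ℝ) / (1 + t) = √2 * Real.pi := by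
  rw [← integral_comp_rpow_Ioi _ (show (4 : ℝ) ≠ 0 by norm_num), ← integrableOn_integral_quartic.2]
  exact setIntegral_congr_fun measurableSet_Ioi fun v hv => quartic_subst hv

/-- Balakrishnan's formula for numbers: for x = 1/(p + a) the factor x/(1 + t x) is 1/(p + a + t).
It follows by scaling t by x. -/
theorem integral_rpow_mul_div {x : ℝ} (hx : 0 ≤ x) :
    ∫ t in Ioi (0 : ℝ), t ^ (-(1 / 4) : ℝ) * (x / (1 + t * x)) =
      √2 * Real.pi * x ^ (1 / 4 : ℝ) := by
  rcases eq_or_lt_of_le hx with h | h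
  · rw [← h]; simp
  have := integral_comp_mul_left_Ioi (fun t : ℝ => t ^ (-(1 / 4) : ℝ) / (1 + t)) 0 h
  rw [mul_zero, integral_rpow_div_one_add, smul_eq_mul] at this
  have e : ∫ t in Ioi (0 : ℝ), t ^ (-(1 / 4) : ℝ) * (x / (1 + t * x)) =
      x * x ^ (1 / 4 : ℝ) * ∫ t in Ioi (0 : ℝ), (x * t) ^ (-(1 / 4) : ℝ) / (1 + x * t) := by
    rw [← integral_const_mul]
    refine setIntegral_congr_fun measurableSet_Ioi fun t ht => ?_
    have ht0 : 0 < t := ht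
    have hx4 : x ^ (1 / 4 : ℝ) ≠ 0 := (Real.rpow_pos_of_pos h _).ne'
    rw [Real.mul_rpow hx ht0.le, Real.rpow_neg hx (1 / 4)]
    have : 1 + t * x ≠ 0 := by positivity
    have : 1 + x * t ≠ 0 := by positivity
    field_simp
  rw [e, this]
  have := h.ne'
  field_simp

/-! ### Resolvent families -/

section Resolvent

variable {H : Type*} [NormedAddCommGroup H] [InnerProductSpace ℂ H] [CompleteSpace H]

open scoped InnerProductSpace

/-- A family with the properties of `a ↦ (T + a)⁻¹`, `a > 0`, for a nonnegative self-adjoint `T`. -/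
structure IsResolventFamily (S : ℝ → H →L[ℂ] H) : Prop where
  nonneg : ∀ a, 0 < a → 0 ≤ S a
  sub_eq : ∀ a b, 0 < a → 0 < b → S a - S b = (b - a) • (S a * S b)
  injective : ∀ a, 0 < a → Function.Injective (S a)

namespace IsResolventFamily

variable {S : ℝ → H →L[ℂ] H} (hS : IsResolventFamily S)
include hS

omit [CompleteSpace H] in
theorem commute {a b : ℝ} (ha : 0 < a) (hb : 0 < b) : Commute (S a) (S b) := by
  rcases eq_or_ne a b with h | h
  · rw [h]
  have h1 := hS.sub_eq a b ha hb
  have h2 := hS.sub_eq b a hb ha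
  have h3 : (b - a) • (S a * S b) = (b - a) • (S b * S a) := by
    rw [← h1, ← neg_sub (S b), h2, ← neg_smul, neg_sub]
  exact smul_right_injective _ (sub_ne_zero.2 h.symm) h3

theorem antitone {a b : ℝ} (ha : 0 < a) (hab : a ≤ b) : S b ≤ S a := by
  have hb := ha.trans_le hab
  rw [← sub_nonneg, hS.sub_eq a b ha hb]
  exact smul_nonneg (sub_nonneg.2 hab)
    ((hS.commute ha hb).mul_nonneg (hS.nonneg a ha) (hS.nonneg b hb))

/-- A point x > 1 of the spectrum of S_1 would correspond to the spectral value x⁻¹ - 1 = -m of the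
generator with 0 < m. But S_m exists, and the resolvent identity makes 1 + x⁻¹ S_m an inverse of 1 -
x⁻¹ S_1. -/
theorem one_le : S 1 ≤ 1 := by
  have hsa : IsSelfAdjoint (S 1) := IsSelfAdjoint.of_nonneg (hS.nonneg 1 one_pos)
  have : S 1 ≤ algebraMap ℝ (H →L[ℂ] H) 1 := by
    rw [le_algebraMap_iff_spectrum_le (p := IsSelfAdjoint)]
    · intro x hx
      by_contra! h
      have hx0 : 0 < x := by linarith
      set m : ℝ := 1 - x⁻¹ with hm
      have hm0 : 0 < m := by
        have := inv_lt_one_of_one_lt₀ h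
        rw [hm]; linarith
      have e := hS.sub_eq m 1 hm0 one_pos
      have e' := hS.commute hm0 one_pos
      have k1 : (1 + x⁻¹ • S m) * (1 - x⁻¹ • S 1) = 1 := by
        have : S m - S 1 = x⁻¹ • (S m * S 1) := by rw [e, hm]; congr 1; ring
        calc _ = 1 + x⁻¹ • (S m - S 1 - x⁻¹ • (S m * S 1)) := by
              simp only [add_mul, mul_sub, one_mul, mul_one, smul_mul_assoc, mul_smul_comm,
                smul_sub]
              module
          _ = 1 := by rw [this]; simp
      have k2 : (1 - x⁻¹ • S 1) * (1 + x⁻¹ • S m) = 1 := by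
        have c : Commute (1 - x⁻¹ • S 1) (1 + x⁻¹ • S m) :=
          ((Commute.one_left _).sub_left (((Commute.one_right _).add_right
            ((e'.symm.smul_right _))).smul_left _))
        rw [c.eq, k1]
      have hu : IsUnit (1 - x⁻¹ • S 1) := ⟨⟨_, _, k2, k1⟩, rfl⟩
      refine hx ?_
      change IsUnit (algebraMap ℝ (H →L[ℂ] H) x - S 1)
      have : algebraMap ℝ (H →L[ℂ] H) x - S 1 = x • (1 - x⁻¹ • S 1) := by
        rw [smul_sub, smul_smul, mul_inv_cancel₀ hx0.ne', one_smul, Algebra.algebraMap_eq_smul_one]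
      rw [this]
      exact hu.smul (Units.mk0 x hx0.ne')
  simpa using this

/-- The constant comes from S_a = S_b + (b - a) S_a S_b and S_a S_b ≤ ‖S_a‖ S_b, the latter because
the factors commute. This comparison makes the range of the fourth root independent of the
parameter. -/
theorem exists_le_smul {a b : ℝ} (ha : 0 < a) (hb : 0 < b) :
    ∃ c : ℝ, 0 < c ∧ S a ≤ c • S b := by
  refine ⟨1 + |b - a| * ‖S a‖, by positivity, ?_⟩
  have hSa := hS.nonneg a ha
  have hSb := hS.nonneg b hb
  have h0 : 0 ≤ S a * S b := (hS.commute ha hb).mul_nonneg hSa hSb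
  have h1 : S a * S b ≤ ‖S a‖ • S b := by
    have h2 : 0 ≤ algebraMap ℝ (H →L[ℂ] H) ‖S a‖ - S a :=
      sub_nonneg.2 (IsSelfAdjoint.le_algebraMap_norm_self (IsSelfAdjoint.of_nonneg hSa))
    have h3 : Commute (algebraMap ℝ (H →L[ℂ] H) ‖S a‖ - S a) (S b) :=
      Commute.sub_left (Algebra.commutes _ _) (hS.commute ha hb)
    have := h3.mul_nonneg h2 hSb
    rwa [sub_mul, sub_nonneg, Algebra.algebraMap_eq_smul_one, smul_mul_assoc, one_mul] at this
  have h4 : S a = S b + (b - a) • (S a * S b) := by rw [← hS.sub_eq a b ha hb]; abel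
  calc S a = S b + (b - a) • (S a * S b) := h4
    _ ≤ S b + |b - a| • (S a * S b) := by
        gcongr
        exact le_abs_self _
    _ ≤ S b + |b - a| • (‖S a‖ • S b) := by gcongr
    _ = (1 + |b - a| * ‖S a‖) • S b := by rw [add_smul, one_smul, smul_smul]

theorem range_quarter_le {a b : ℝ} (ha : 0 < a) (hb : 0 < b) :
    (S a ^ (1 / 4 : ℝ) : H →L[ℂ] H).range ≤ (S b ^ (1 / 4 : ℝ) : H →L[ℂ] H).range := by
  obtain ⟨c, hc, h⟩ := hS.exists_le_smul ha hb
  have hi : Function.Injective (c • S b : H →L[ℂ] H) :=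
    (smul_right_injective H hc.ne').comp (hS.injective b hb)
  exact (PointInteraction.range_quarter_le (hS.nonneg a ha) h hi).trans
    (range_quarter_smul_le (hS.nonneg b hb) hc)

theorem range_quarter_eq {a b : ℝ} (ha : 0 < a) (hb : 0 < b) :
    (S a ^ (1 / 4 : ℝ) : H →L[ℂ] H).range = (S b ^ (1 / 4 : ℝ) : H →L[ℂ] H).range :=
  le_antisymm (hS.range_quarter_le ha hb) (hS.range_quarter_le hb ha)

/-- Both sides solve X (1 + t S_a) = S_a, and 1 + t S_a is cancelled by means of its right inverse 1
- t S_{a+t}. -/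
theorem cfc_resolvent {a t : ℝ} (ha : 0 < a) (ht : 0 ≤ t) :
    cfc (fun x : ℝ => x / (1 + t * x)) (S a) = S (a + t) := by
  have hat : 0 < a + t := by linarith
  have hsa : IsSelfAdjoint (S a) := IsSelfAdjoint.of_nonneg (hS.nonneg a ha)
  have hpos : ∀ x ∈ spectrum ℝ (S a), 1 + t * x ≠ 0 := fun x hx => by
    have := spectrum_nonneg_of_nonneg (hS.nonneg a ha) hx
    positivity
  have e1 : cfc (fun x : ℝ => x / (1 + t * x)) (S a) * (1 + t • S a) = S a := by
    have : 1 + t • S a = cfc (fun x : ℝ => 1 + t * x) (S a) := by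
      rw [cfc_add (S a) (fun _ : ℝ => (1 : ℝ)) (fun x => t * x), cfc_const_one ℝ (S a),
        cfc_const_mul t (fun x => x) (S a), cfc_id' ℝ (S a)]
    have hc : ContinuousOn (fun x : ℝ => x / (1 + t * x)) (spectrum ℝ (S a)) :=
      ContinuousOn.div (by fun_prop) (by fun_prop) hpos
    rw [this, ← cfc_mul _ _ (S a) hc]
    conv_rhs => rw [← cfc_id' ℝ (S a)]
    exact cfc_congr fun x hx => div_mul_cancel₀ _ (hpos x hx)
  have r := hS.sub_eq a (a + t) ha hat
  rw [add_sub_cancel_left] at r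
  have c := hS.commute ha hat
  have e2 : S (a + t) * (1 + t • S a) = S a := by
    rw [mul_add, mul_one, mul_smul_comm, ← c.eq, ← r]
    abel
  have e3 : (1 + t • S a) * (1 - t • S (a + t)) = 1 := by
    have : (1 + t • S a) * (1 - t • S (a + t)) =
        1 + t • (S a - S (a + t) - t • (S a * S (a + t))) := by
      simp only [add_mul, mul_sub, one_mul, mul_one, smul_mul_assoc, mul_smul_comm, smul_sub]
      module
    rw [this, r, sub_self, smul_zero, add_zero]
  calc cfc (fun x : ℝ => x / (1 + t * x)) (S a)
      = cfc (fun x : ℝ => x / (1 + t * x)) (S a) * (1 + t • S a) * (1 - t • S (a + t)) := by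
        rw [mul_assoc, e3, mul_one]
    _ = S (a + t) * (1 + t • S a) * (1 - t • S (a + t)) := by rw [e1, e2]
    _ = S (a + t) := by rw [mul_assoc, e3, mul_one]

/-- Balakrishnan's formula for the power `1 / 4` of a resolvent. -/
theorem quarter_eq_integral {a : ℝ} (ha : 0 < a) :
    IntegrableOn (fun t : ℝ => t ^ (-(1 / 4) : ℝ) • S (a + t)) (Ioi 0) ∧
    (√2 * Real.pi) • S a ^ (1 / 4 : ℝ) = ∫ t in Ioi (0 : ℝ), t ^ (-(1 / 4) : ℝ) • S (a + t) := by
  have h0 := hS.nonneg a ha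
  have hsa : IsSelfAdjoint (S a) := IsSelfAdjoint.of_nonneg h0
  let f : ℝ → ℝ → ℝ := fun t x => t ^ (-(1 / 4) : ℝ) * (x / (1 + t * x))
  have hfc : ∀ t ∈ Ioi (0 : ℝ), cfc (f t) (S a) = t ^ (-(1 / 4) : ℝ) • S (a + t) := by
    intro t ht
    have ht0 : 0 < t := ht
    have hc : ContinuousOn (fun x : ℝ => x / (1 + t * x)) (spectrum ℝ (S a)) :=
      ContinuousOn.div (by fun_prop) (by fun_prop) fun x hx => by
        have := spectrum_nonneg_of_nonneg h0 hx
        positivity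
    rw [← hS.cfc_resolvent ha ht0.le, ← cfc_smul _ _ _ hc]
    rfl
  have hcont : ContinuousOn (Function.uncurry f) (Ioi 0 ×ˢ spectrum ℝ (S a)) := by
    rintro ⟨t, x⟩ ⟨ht, hx⟩
    have ht0 : 0 < t := ht
    have hx0 : 0 ≤ x := spectrum_nonneg_of_nonneg h0 hx
    refine ContinuousAt.continuousWithinAt ?_
    refine ContinuousAt.mul (ContinuousAt.rpow_const (by fun_prop) (Or.inl ht0.ne')) ?_
    exact ContinuousAt.div (by fun_prop) (by fun_prop) (by positivity)
  -- A bound for the spectrum. The factor ‖1‖ is there because `H` may be trivial, where it is 0.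
  let M : ℝ := ‖S a‖ * ‖(1 : H →L[ℂ] H)‖
  have hM : 0 ≤ M := by positivity
  have hbd : ∀ᵐ t ∂(volume.restrict (Ioi (0 : ℝ))), ∀ x ∈ spectrum ℝ (S a),
      ‖f t x‖ ≤ (1 + M) * (t ^ (-(1 / 4) : ℝ) / (1 + t)) := by
    refine ae_restrict_of_forall_mem measurableSet_Ioi fun t ht x hx => ?_
    have ht0 : 0 < t := ht
    have hx0 : 0 ≤ x := spectrum_nonneg_of_nonneg h0 hx
    have hx1 : x ≤ M := (le_abs_self x).trans (spectrum.norm_le_norm_mul_of_mem hx)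
    have hp : 0 < t ^ (-(1 / 4) : ℝ) := Real.rpow_pos_of_pos ht0 _
    rw [Real.norm_of_nonneg (by positivity)]
    have : x / (1 + t * x) ≤ (1 + M) / (1 + t) := by
      rw [div_le_div_iff₀ (by positivity) (by positivity)]
      nlinarith [mul_nonneg ht0.le hx0, hM, mul_nonneg (hM)
        (mul_nonneg ht0.le hx0)]
    calc f t x ≤ t ^ (-(1 / 4) : ℝ) * ((1 + M) / (1 + t)) :=
          mul_le_mul_of_nonneg_left this hp.le
      _ = _ := by ring
  have hbi : HasFiniteIntegral (fun t : ℝ => (1 + M) * (t ^ (-(1 / 4) : ℝ) / (1 + t)))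
      (volume.restrict (Ioi (0 : ℝ))) := (integrableOn_rpow_div_one_add.const_mul _).2
  refine ⟨(integrableOn_cfc measurableSet_Ioi f _ (S a) hcont hbd hbi).congr_fun hfc
    measurableSet_Ioi, ?_⟩
  rw [← setIntegral_congr_fun measurableSet_Ioi hfc,
    ← cfc_setIntegral measurableSet_Ioi f _ (S a) hcont hbd hbi, CFC.rpow_eq_cfc_real h0,
    ← cfc_smul _ _ _ (Real.continuous_rpow_const (by norm_num)).continuousOn]
  exact cfc_congr fun x hx => (integral_rpow_mul_div (spectrum_nonneg_of_nonneg h0 hx)).symm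

theorem quarter_apply_eq_integral {a : ℝ} (ha : 0 < a) (u : H) :
    IntegrableOn (fun t : ℝ => t ^ (-(1 / 4) : ℝ) • S (a + t) u) (Ioi 0) ∧
    (√2 * Real.pi) • (S a ^ (1 / 4 : ℝ)) u =
      ∫ t in Ioi (0 : ℝ), t ^ (-(1 / 4) : ℝ) • S (a + t) u := by
  obtain ⟨hi, he⟩ := hS.quarter_eq_integral ha
  refine ⟨(ContinuousLinearMap.apply ℂ H u).integrable_comp hi, ?_⟩
  have := congrArg (fun A : H →L[ℂ] H => A u) he
  rw [ContinuousLinearMap.integral_apply hi u] at this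
  exact this

end IsResolventFamily
end Resolvent

/-! ### Rank-one perturbations of a resolvent family. -/

section Perturbation

variable {H : Type*} [NormedAddCommGroup H] [InnerProductSpace ℂ H] [CompleteSpace H]

open scoped InnerProductSpace

/-- If `K ^ (1/4)` factors through `P` by `C`, `P g` is outside the range of `Q` and `P g` can be
approximated suitably by elements of the range of `Q`, then the range of `P` is more than the
range of `Q` and `P g`. -/
theorem not_range_le_sup_span {P Q C : H →L[ℂ] H} (hP : IsSelfAdjoint P)
    (hPi : Function.Injective P) (hQi : Function.Injective Q) (hC : Q = P * C) {g : H}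
    (hg : P g ∉ Q.range) {z : ℕ → H} {M : ℝ} (hz : ∀ n, ‖z n‖ ≤ M)
    (hz0 : Filter.Tendsto (fun n => P (z n)) Filter.atTop (nhds 0))
    (hzQ : ∀ n, P g + P (z n) ∈ Q.range) :
    ¬ P.range ≤ Q.range ⊔ Submodule.span ℂ {P g} := by
  intro hle
  have hCa : ∀ x, Q x = P (C x) := fun x => by rw [hC]; rfl
  have hker : C.ker = ⊥ := by
    rw [LinearMap.ker_eq_bot]
    intro x y hxy
    exact hQi (by rw [hCa, hCa]; exact congrArg P hxy)
  -- Injectivity of `P` transports the assumed inclusion back to `H`: the range of `C` and the line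
  -- of g are algebraic complements.
  have hcompl : IsCompl C.range (Submodule.span ℂ {g}) := by
    constructor
    · rw [Submodule.disjoint_def]
      rintro _ ⟨x, rfl⟩ hx
      obtain ⟨c, hc⟩ := Submodule.mem_span_singleton.1 hx
      rcases eq_or_ne c 0 with h | h
      · rw [← hc, h, zero_smul]
      · exfalso
        refine hg ⟨c⁻¹ • x, ?_⟩
        have : Q x = c • P g := by rw [hCa, ← map_smul]; exact congrArg P hc.symm
        change Q (c⁻¹ • x) = P g
        rw [map_smul, this, smul_smul, inv_mul_cancel₀ h, one_smul]
    · rw [codisjoint_iff, eq_top_iff]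
      intro v _
      obtain ⟨_, ⟨x, rfl⟩, y, hy, hxy⟩ := Submodule.mem_sup.1 (hle ⟨v, rfl⟩)
      obtain ⟨c, rfl⟩ := Submodule.mem_span_singleton.1 hy
      refine Submodule.mem_sup.2 ⟨C x, ⟨x, rfl⟩, c • g, Submodule.smul_mem _ _
        (Submodule.mem_span_singleton_self g), hPi ?_⟩
      rw [map_add, ← hCa, map_smul]
      exact hxy
  -- The range of an injective bounded operator that has a closed algebraic complement is closed. It
  -- therefore has a nonzero orthogonal vector w once it is known to be proper.
  have hclosed : IsClosed (C.range : Set H) :=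
    C.closed_complemented_range_of_isCompl_of_ker_eq_bot _ hcompl
      (Submodule.closed_of_finiteDimensional _) hker
  have : CompleteSpace C.range := hclosed.completeSpace_coe
  have htop : C.range ≠ ⊤ := by
    intro h
    obtain ⟨x, hx⟩ := (h ▸ Submodule.mem_top : g ∈ C.range)
    exact hg ⟨x, (hCa x).trans (congrArg P hx)⟩
  have hbot : C.rangeᗮ ≠ ⊥ := fun h => htop ((Submodule.orthogonal_eq_bot_iff).1 h)
  obtain ⟨w, hw, hw0⟩ := Submodule.exists_mem_ne_zero_of_ne_bot hbot
  have hwC : ∀ x, ⟪w, C x⟫_ℂ = 0 := fun x =>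
    (Submodule.mem_orthogonal' _ _).1 hw _ ⟨x, rfl⟩
  have hwz : ∀ n, ⟪w, z n⟫_ℂ = -⟪w, g⟫_ℂ := by
    intro n
    obtain ⟨x, hx⟩ := hzQ n
    have : g + z n = C x := hPi (by rw [map_add, ← hCa]; exact hx.symm)
    have h2 := hwC x
    rw [← this, inner_add_right] at h2
    exact eq_neg_of_add_eq_zero_right h2
  have hM : 0 ≤ M := (norm_nonneg _).trans (hz 0)
  -- The sequence z_n tends weakly to 0: it is bounded, and its inner products with the dense set of
  -- vectors P y tend to 0. As ⟨w, z_n⟩ is constantly -⟨w, g⟩, that constant is 0, so w is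
  -- orthogonal to both summands.
  have hlim : ⟪w, g⟫_ℂ = 0 := by
    rw [← norm_le_zero_iff]
    refine le_of_forall_pos_le_add fun ε hε => ?_
    have hd := denseRange_of_isSelfAdjoint_of_injective hP hPi
    obtain ⟨y, hy⟩ := hd.exists_dist_lt w (show 0 < ε / (2 * (M + 1)) by positivity)
    rw [dist_eq_norm] at hy
    have ht : Filter.Tendsto (fun n => ‖y‖ * ‖P (z n)‖) Filter.atTop (nhds 0) := by
      simpa using (hz0.norm).const_mul ‖y‖
    obtain ⟨n, hn⟩ := (ht.eventually (gt_mem_nhds (half_pos hε))).exists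
    have e : ⟪w, z n⟫_ℂ = ⟪w - P y, z n⟫_ℂ + ⟪y, P (z n)⟫_ℂ := by
      rw [inner_sub_left, ← ContinuousLinearMap.adjoint_inner_left, hP.adjoint_eq]
      ring
    have : ‖⟪w, g⟫_ℂ‖ = ‖⟪w, z n⟫_ℂ‖ := by rw [hwz, norm_neg]
    rw [this, e]
    have h1 : ‖⟪w - P y, z n⟫_ℂ‖ ≤ ε / 2 := by
      calc _ ≤ ‖w - P y‖ * ‖z n‖ := norm_inner_le_norm _ _
        _ ≤ ε / (2 * (M + 1)) * (M + 1) := by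
          gcongr
          exact (hz n).trans (by linarith)
        _ = ε / 2 := by field_simp
    have h2 : ‖⟪y, P (z n)⟫_ℂ‖ ≤ ε / 2 := (norm_inner_le_norm _ _).trans hn.le
    linarith [norm_add_le ⟪w - P y, z n⟫_ℂ ⟪y, P (z n)⟫_ℂ]
  refine hw0 (inner_self_eq_zero (𝕜 := ℂ) |>.1 ?_)
  have : w ∈ C.range ⊔ Submodule.span ℂ {g} := hcompl.sup_eq_top ▸ Submodule.mem_top
  obtain ⟨_, ⟨x, rfl⟩, y, hy, hxy⟩ := Submodule.mem_sup.1 this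
  obtain ⟨c, rfl⟩ := Submodule.mem_span_singleton.1 hy
  conv_lhs =>
    arg 3
    rw [← hxy]
  rw [inner_add_right, inner_smul_right, hlim]
  have : ⟪w, (C : H →ₗ[ℂ] H) x⟫_ℂ = 0 := hwC x
  rw [this]
  simp

/-- The data of a rank-one perturbation of a resolvent family by the vectors `G a`. -/
structure IsGreenFamily (K : ℝ → H →L[ℂ] H) (G : ℝ → H) : Prop where
  resolvent : IsResolventFamily K
  sub_eq : ∀ a b, 0 < a → 0 < b → G a - G b = ((b - a : ℝ) : ℂ) • K a (G b)
  inner_eq : ∀ a b, 0 < a → 0 < b →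
    ⟪G a, G b⟫_ℂ = ((1 / (4 * Real.pi * (√a + √b)) : ℝ) : ℂ)

/-- The coupling factor `1 / (α + √a / 4π)`. -/
def coupling (α a : ℝ) : ℝ := (α + √a / (4 * Real.pi))⁻¹

theorem coupling_pos {α a : ℝ} (hα : 0 ≤ α) (ha : 0 < a) : 0 < coupling α a := by
  have := Real.sqrt_pos.2 ha
  have := Real.pi_pos
  unfold coupling
  positivity

/-- The resolvents of the point interaction. -/
def perturbed (α : ℝ) (K : ℝ → H →L[ℂ] H) (G : ℝ → H) (a : ℝ) : H →L[ℂ] H :=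
  K a + coupling α a • InnerProductSpace.rankOne ℂ (G a) (G a)

omit [CompleteSpace H] in
theorem perturbed_apply (α : ℝ) (K : ℝ → H →L[ℂ] H) (G : ℝ → H) (a : ℝ) (x : H) :
    perturbed α K G a x = K a x + ((coupling α a : ℂ) * ⟪G a, x⟫_ℂ) • G a := by
  rw [perturbed, add_apply, smul_apply, InnerProductSpace.rankOne_apply, ← Complex.coe_smul,
    smul_smul]

omit [CompleteSpace H] in
theorem rankOne_self_nonneg (x : H) : 0 ≤ InnerProductSpace.rankOne ℂ x x := by
  rw [ContinuousLinearMap.nonneg_iff_isPositive]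
  exact InnerProductSpace.isPositive_rankOne_self x

namespace IsGreenFamily

variable {K : ℝ → H →L[ℂ] H} {G : ℝ → H} (h : IsGreenFamily K G) {α : ℝ} (hα : 0 ≤ α)
include h

omit [CompleteSpace H] in
theorem norm_sq {a : ℝ} (ha : 0 < a) : ‖G a‖ ^ 2 = 1 / (8 * Real.pi * √a) := by
  have := h.inner_eq a a ha ha
  rw [inner_self_eq_norm_sq_to_K] at this
  have h2 : ‖G a‖ ^ 2 = 1 / (4 * Real.pi * (√a + √a)) := Complex.ofReal_injective (by
    rw [← this]; simp)
  rw [h2]; ring_nf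

include hα

omit h in
theorem le_perturbed {a : ℝ} (ha : 0 < a) : K a ≤ perturbed α K G a :=
  le_add_of_nonneg_right (smul_nonneg (coupling_pos hα ha).le (rankOne_self_nonneg _))

omit hα in
theorem rankOne_le_perturbed {a : ℝ} (ha : 0 < a) :
    coupling α a • InnerProductSpace.rankOne ℂ (G a) (G a) ≤ perturbed α K G a :=
  le_add_of_nonneg_left (h.resolvent.nonneg a ha)

/-- The resolvent identity reduces to (b - a) β_a β_b ⟨G_a, G_b⟩ = β_a - β_b, where β is the
coupling: 1/β_b - 1/β_a = (√b - √a)/4π is exactly (b - a)⟨G_a, G_b⟩. Injectivity follows from that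
of K_a, since K_a is a lower bound. -/
theorem isResolventFamily_perturbed : IsResolventFamily (perturbed α K G) where
  nonneg a ha := (h.resolvent.nonneg a ha).trans (le_perturbed hα ha)
  injective a ha := by
    rw [injective_iff_map_eq_zero]
    intro x hx
    have h1 := re_inner_le_of_le (le_perturbed (K := K) (G := G) hα ha) x
    rw [hx, inner_zero_left, ← norm_sq_eq_re_inner (isSelfAdjoint_rpow (K a) (1 / 2))
      (sqrtP_mul_self (h.resolvent.nonneg a ha))] at h1
    have h2 : ((K a) ^ (1 / 2 : ℝ) : H →L[ℂ] H) x = 0 := by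
      rw [← norm_eq_zero]
      exact pow_eq_zero_iff two_ne_zero |>.1 (le_antisymm (by simpa using h1) (sq_nonneg _))
    exact injective_half (h.resolvent.nonneg a ha) (h.resolvent.injective a ha)
      (by rw [h2, map_zero])
  sub_eq a b ha hb := by
    ext x
    have hKa : IsSelfAdjoint (K b) := IsSelfAdjoint.of_nonneg (h.resolvent.nonneg b hb)
    have e1 : K a x - K b x = ((b - a : ℝ) : ℂ) • K a (K b x) := by
      have := congrArg (fun A : H →L[ℂ] H => A x) (h.resolvent.sub_eq a b ha hb)
      simpa only [sub_apply, smul_apply, mul_apply_eq_comp, Complex.coe_smul] using this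
    have e2 := h.sub_eq a b ha hb
    have e3 : ((b - a : ℝ) : ℂ) * ⟪G a, K b x⟫_ℂ = ⟪G a, x⟫_ℂ - ⟪G b, x⟫_ℂ := by
      have k := h.sub_eq b a hb ha
      have : ⟪G a, K b x⟫_ℂ = ⟪K b (G a), x⟫_ℂ := by
        rw [← ContinuousLinearMap.adjoint_inner_left, hKa.adjoint_eq]
      rw [this, ← inner_sub_left, ← neg_sub (G b), k, ← neg_smul, ← Complex.ofReal_neg, neg_sub,
        inner_smul_left, Complex.conj_ofReal]
    have e4 : ((b - a : ℝ) : ℂ) * (coupling α a * coupling α b * ⟪G a, G b⟫_ℂ) =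
        coupling α a - coupling α b := by
      rw [h.inner_eq a b ha hb]
      norm_cast
      have hpi := Real.pi_pos
      have sa := Real.sqrt_pos.2 ha
      have sb := Real.sqrt_pos.2 hb
      have ca : α + √a / (4 * Real.pi) ≠ 0 := by positivity
      have cb : α + √b / (4 * Real.pi) ≠ 0 := by positivity
      have hba : b - a = (√b - √a) * (√a + √b) := by
        nlinarith [Real.sq_sqrt ha.le, Real.sq_sqrt hb.le]
      unfold coupling
      rw [hba, inv_sub_inv ca cb]
      field_simp
      ring
    have e5 : perturbed α K G a (perturbed α K G b x) =
        K a (K b x) + (coupling α b * ⟪G b, x⟫_ℂ) • K a (G b) +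
          (coupling α a * (⟪G a, K b x⟫_ℂ + coupling α b * ⟪G b, x⟫_ℂ * ⟪G a, G b⟫_ℂ)) • G a := by
      rw [perturbed_apply, perturbed_apply, map_add, map_smul, inner_add_right, inner_smul_right]
    have e6 : ((b - a : ℝ) : ℂ) • perturbed α K G a (perturbed α K G b x) =
        ((b - a : ℝ) : ℂ) • K a (K b x)
          + (coupling α b * ⟪G b, x⟫_ℂ) • (((b - a : ℝ) : ℂ) • K a (G b))
          + (coupling α a * (((b - a : ℝ) : ℂ) * ⟪G a, K b x⟫_ℂ) + ⟪G b, x⟫_ℂ *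
            (((b - a : ℝ) : ℂ) * (coupling α a * coupling α b * ⟪G a, G b⟫_ℂ))) • G a := by
      rw [e5]
      module
    rw [sub_apply, smul_apply, mul_apply_eq_comp, ← Complex.coe_smul, e6, e3, e4, ← e1, ← e2,
      perturbed_apply, perturbed_apply]
    module

theorem range_quarter_le_perturbed {a : ℝ} (ha : 0 < a) :
    (K a ^ (1 / 4 : ℝ) : H →L[ℂ] H).range ≤ (perturbed α K G a ^ (1 / 4 : ℝ) : H →L[ℂ] H).range :=
  range_quarter_le (h.resolvent.nonneg a ha) (le_perturbed hα ha)
    ((h.isResolventFamily_perturbed hα).injective a ha)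

/-- The vectors `G b`, `b ≥ a`, lie in the range of the power `1 / 2`, with a bound. -/
theorem exists_half_eq {a b : ℝ} (ha : 0 < a) (hab : a ≤ b) :
    ∃ y : H, (perturbed α K G a ^ (1 / 2 : ℝ) : H →L[ℂ] H) y = G b ∧
      ‖y‖ ^ 2 ≤ α + √b / (4 * Real.pi) := by
  have hR := h.isResolventFamily_perturbed hα
  have hb := ha.trans_le hab
  obtain ⟨y, hy, hn⟩ := exists_half_eq_of_rankOne_le (hR.nonneg a ha) (hR.injective a ha) (G b)
    (coupling_pos hα hb) ((h.rankOne_le_perturbed hb).trans (hR.antitone ha hab))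
  refine ⟨y, hy, hn.trans_eq ?_⟩
  rw [coupling, one_div, inv_inv]

/-- With R^{1/2} y = G_b take z = R^{1/4} y; then ‖z‖² = ⟨G_b, y⟩. The growth √b of the bound for
‖y‖² is compensated by the decay of ‖G_b‖², so the bound for z stays bounded as b → ∞. -/
theorem exists_quarter_eq {a b : ℝ} (ha : 0 < a) (hab : a ≤ b) :
    ∃ z : H, (perturbed α K G a ^ (1 / 4 : ℝ) : H →L[ℂ] H) z = G b ∧
      ‖z‖ ^ 4 ≤ (α + √b / (4 * Real.pi)) * (1 / (8 * Real.pi * √b)) := by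
  have hR := h.isResolventFamily_perturbed hα
  obtain ⟨y, hy, hn⟩ := h.exists_half_eq hα ha hab
  have hq := quarter_mul_self (hR.nonneg a ha)
  refine ⟨(perturbed α K G a ^ (1 / 4 : ℝ) : H →L[ℂ] H) y, ?_, ?_⟩
  · rw [← hy, ← hq]; rfl
  · have h1 := norm_sq_eq_re_inner (isSelfAdjoint_rpow (perturbed α K G a) (1 / 4)) hq y
    rw [hy] at h1
    have h2 : ‖(perturbed α K G a ^ (1 / 4 : ℝ) : H →L[ℂ] H) y‖ ^ 2 ≤ ‖G b‖ * ‖y‖ :=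
      h1.le.trans (((Complex.re_le_norm _)).trans (norm_inner_le_norm _ _))
    rw [← h.norm_sq (ha.trans_le hab)]
    calc ‖(perturbed α K G a ^ (1 / 4 : ℝ) : H →L[ℂ] H) y‖ ^ 4
        = (‖(perturbed α K G a ^ (1 / 4 : ℝ) : H →L[ℂ] H) y‖ ^ 2) ^ 2 := by ring
      _ ≤ (‖G b‖ * ‖y‖) ^ 2 := by gcongr
      _ = ‖y‖ ^ 2 * ‖G b‖ ^ 2 := by ring
      _ ≤ _ := by gcongr

/-- The criterion `not_range_le_sup_span` is applied to the preimages of -G_{a+n}. They are bounded,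
their images tend to 0, and G_a - G_{a+n} = n K_a G_{a+n} is already in the range of K_a. -/
theorem sup_span_lt {a : ℝ} (ha : 0 < a) (hG : G a ∉ (K a ^ (1 / 4 : ℝ) : H →L[ℂ] H).range) :
    (K a ^ (1 / 4 : ℝ) : H →L[ℂ] H).range ⊔ Submodule.span ℂ {G a} <
      (perturbed α K G a ^ (1 / 4 : ℝ) : H →L[ℂ] H).range := by
  have hR := h.isResolventFamily_perturbed hα
  have hK := h.resolvent
  choose! z hz hzn using fun b (hab : a ≤ b) => h.exists_quarter_eq hα ha hab
  rw [lt_iff_le_not_ge]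
  refine ⟨sup_le (h.range_quarter_le_perturbed hα ha) ?_, ?_⟩
  · rw [Submodule.span_singleton_le_iff_mem]
    exact ⟨z a, hz a le_rfl⟩
  · obtain ⟨C, hC⟩ := exists_factor_quarter (hK.nonneg a ha)
      (le_perturbed (K := K) (G := G) hα ha) (hR.injective a ha)
    have hn : ∀ n : ℕ, a ≤ a + n := fun n => le_add_of_nonneg_right n.cast_nonneg
    have hpi := Real.pi_pos
    have hsa := Real.sqrt_pos.2 ha
    rw [← hz a le_rfl] at hG ⊢
    refine not_range_le_sup_span (C := C) (z := fun n : ℕ => -z (a + n))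
      -- The estimate available is for ‖z‖⁴; the maximum with 1 gives M ≤ M⁴.
      (M := (max 1 (α / (8 * Real.pi * √a) + 1 / (32 * Real.pi ^ 2))))
      (isSelfAdjoint_rpow _ _) (injective_quarter (hR.nonneg a ha) (hR.injective a ha))
      (injective_quarter (hK.nonneg a ha) (hK.injective a ha)) hC hG ?_ ?_ ?_
    · intro n
      rw [norm_neg]
      set M := max 1 (α / (8 * Real.pi * √a) + 1 / (32 * Real.pi ^ 2)) with hM
      have hM1 : 1 ≤ M := le_max_left _ _
      refine le_of_pow_le_pow_left₀ (n := 4) (by norm_num) (by linarith) ?_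
      have hsb : √a ≤ √(a + n) := Real.sqrt_le_sqrt (hn n)
      have hsb0 : 0 < √(a + n) := hsa.trans_le hsb
      calc ‖z (a + n)‖ ^ 4
          ≤ (α + √(a + n) / (4 * Real.pi)) * (1 / (8 * Real.pi * √(a + n))) := hzn _ (hn n)
        _ = α / (8 * Real.pi * √(a + n)) + 1 / (32 * Real.pi ^ 2) := by field_simp; ring
        _ ≤ α / (8 * Real.pi * √a) + 1 / (32 * Real.pi ^ 2) := by gcongr
        _ ≤ M := le_max_right _ _
        _ ≤ M ^ 4 := le_self_pow₀ hM1 (by norm_num)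
    · rw [tendsto_zero_iff_norm_tendsto_zero]
      have e : ∀ n : ℕ, ‖(perturbed α K G a ^ (1 / 4 : ℝ) : H →L[ℂ] H) (-z (a + n))‖ =
          √(1 / (8 * Real.pi * √(a + n))) := fun n => by
        rw [map_neg, norm_neg, hz _ (hn n), ← h.norm_sq (ha.trans_le (hn n)),
          Real.sqrt_sq (norm_nonneg _)]
      simp only [e]
      have t1 : Filter.Tendsto (fun n : ℕ => 8 * Real.pi * √(a + n)) Filter.atTop Filter.atTop :=
        (Real.tendsto_sqrt_atTop.comp (Filter.tendsto_atTop_add_const_left _ a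
          tendsto_natCast_atTop_atTop)).const_mul_atTop (by positivity)
      have t2 := (Real.continuous_sqrt.tendsto 0).comp (tendsto_inv_atTop_zero.comp t1)
      simpa [Function.comp_def] using t2
    · intro n
      have hb := ha.trans_le (hn n)
      rw [map_neg, hz _ (hn n), hz a le_rfl, ← sub_eq_add_neg, h.sub_eq a _ ha hb]
      refine Submodule.smul_mem _ _
        ⟨(K a ^ (1 / 4 : ℝ) : H →L[ℂ] H) ((K a ^ (1 / 2 : ℝ) : H →L[ℂ] H) (G (a + n))), ?_⟩
      exact (congrArg (fun A : H →L[ℂ] H => A ((K a ^ (1 / 2 : ℝ) : H →L[ℂ] H) (G (a + n))))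
        (quarter_mul_self (hK.nonneg a ha))).trans
        (congrArg (fun A : H →L[ℂ] H => A (G (a + n))) (sqrtP_mul_self (hK.nonneg a ha)))

/-- The difference of the perturbed and the free power `1 / 4`. -/
theorem quarter_sub_eq_integral {a : ℝ} (ha : 0 < a) (u : H) :
    IntegrableOn (fun t : ℝ => (((t ^ (-(1 / 4) : ℝ) * coupling α (a + t) : ℝ) : ℂ) *
      ⟪G (a + t), u⟫_ℂ) • G (a + t)) (Ioi 0) ∧
    ((√2 * Real.pi : ℝ) : ℂ) • ((perturbed α K G a ^ (1 / 4 : ℝ) : H →L[ℂ] H) u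
        - (K a ^ (1 / 4 : ℝ) : H →L[ℂ] H) u) =
      ∫ t in Ioi (0 : ℝ), (((t ^ (-(1 / 4) : ℝ) * coupling α (a + t) : ℝ) : ℂ) *
        ⟪G (a + t), u⟫_ℂ) • G (a + t) := by
  obtain ⟨i1, e1⟩ := (h.isResolventFamily_perturbed hα).quarter_apply_eq_integral ha u
  obtain ⟨i2, e2⟩ := h.resolvent.quarter_apply_eq_integral ha u
  have e : ∀ t : ℝ, t ^ (-(1 / 4) : ℝ) • perturbed α K G (a + t) u
      - t ^ (-(1 / 4) : ℝ) • K (a + t) u =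
      (((t ^ (-(1 / 4) : ℝ) * coupling α (a + t) : ℝ) : ℂ) * ⟪G (a + t), u⟫_ℂ) • G (a + t) := by
    intro t
    rw [perturbed_apply, ← smul_sub, add_sub_cancel_left, ← Complex.coe_smul, smul_smul]
    congr 1
    push_cast
    ring
  have := i1.sub i2
  simp only [e, Pi.sub_def] at this
  refine ⟨this, ?_⟩
  simp only [← e]
  rw [integral_sub i1 i2, ← e1, ← e2, ← smul_sub, Complex.coe_smul]

end IsGreenFamily

end Perturbation

/-! ### The Fourier transform of the Green function -/

/-- The radial profile of the Green function. -/
def greenProfile (a r : ℝ) : ℂ := ((Real.exp (-(a * r)) / (4 * Real.pi * r) : ℝ) : ℂ)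

theorem green_eq_profile (lam : ℝ) (x : E3) : green lam x = greenProfile (√lam) ‖x‖ := rfl

theorem integrable_green {lam : ℝ} (hlam : 0 < lam) : Integrable (green lam) := by
  have h := integrable_fun_norm_addHaar (volume : Measure E3) (f := greenProfile (√lam))
  refine h.2 ?_
  have hs := Real.sqrt_pos.2 hlam
  have h1 : IntegrableOn (fun r : ℝ => r ^ (1 : ℝ) * Real.exp (-√lam * r)) (Ioi 0) :=
    integrableOn_rpow_mul_exp_neg_mul_rpow (s := 1) (p := 1) (by norm_num) one_pos hs |>.congr_fun
      (fun r _ => by simp) measurableSet_Ioi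
  have h2 := (h1.const_mul (1 / (4 * Real.pi))).ofReal (𝕜 := ℂ)
  refine IntegrableOn.congr_fun h2 (fun r hr => ?_) measurableSet_Ioi
  have hr0 : r ≠ 0 := ne_of_gt hr
  have hpi := Real.pi_ne_zero
  simp only [greenProfile, finrank_euclideanSpace, Fintype.card_fin, Real.rpow_one,
    RCLike.ofReal_eq_complex_ofReal]
  rw [← Complex.coe_smul, smul_eq_mul, ← Complex.ofReal_mul]
  congr 1
  field_simp

theorem hasDerivAt_sqrt_sq_add {s r : ℝ} (hs : s ≠ 0) :
    HasDerivAt (fun r : ℝ => √(s ^ 2 + r ^ 2)) (r / √(s ^ 2 + r ^ 2)) r := by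
  have hp : 0 < s ^ 2 + r ^ 2 := by positivity
  have := ((hasDerivAt_pow 2 r).const_add (s ^ 2)).sqrt hp.ne'
  convert! this using 1
  have := (Real.sqrt_pos.2 hp).ne'
  field_simp
  push_cast
  ring

/-- Integrating the three-dimensional Green function over a plane at distance |s| gives the
one-dimensional one. In polar coordinates the integrand is an exact derivative. -/
theorem integral_planar_profile {a s : ℝ} (ha : 0 < a) (hs : s ≠ 0) :
    ∫ y : EuclideanSpace ℝ (Fin 2), greenProfile a (√(s ^ 2 + ‖y‖ ^ 2)) =
      ((Real.exp (-(a * |s|)) / (2 * a) : ℝ) : ℂ) := by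
  have hpi := Real.pi_pos
  have key : ∫ r in Ioi (0 : ℝ), r * (Real.exp (-(a * √(s ^ 2 + r ^ 2))) /
      (4 * Real.pi * √(s ^ 2 + r ^ 2))) = Real.exp (-(a * |s|)) / (4 * Real.pi * a) := by
    have hd : ∀ r ∈ Ici (0 : ℝ), HasDerivAt
        (fun r : ℝ => -(Real.exp (-(a * √(s ^ 2 + r ^ 2))) / (4 * Real.pi * a)))
        (r * (Real.exp (-(a * √(s ^ 2 + r ^ 2))) / (4 * Real.pi * √(s ^ 2 + r ^ 2)))) r := by
      intro r _
      have hp : 0 < √(s ^ 2 + r ^ 2) := Real.sqrt_pos.2 (by positivity)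
      have := ((((hasDerivAt_sqrt_sq_add (r := r) hs).const_mul a).neg.exp).div_const
        (4 * Real.pi * a)).neg
      convert! this using 1
      simp only [Pi.neg_apply]
      field_simp
    have ht : Filter.Tendsto (fun r : ℝ => √(s ^ 2 + r ^ 2)) Filter.atTop Filter.atTop := by
      refine Filter.tendsto_atTop_mono (fun r => ?_) Filter.tendsto_id
      exact Real.le_sqrt_of_sq_le (by simp only [id]; nlinarith [sq_nonneg s])
    have hl : Filter.Tendsto
        (fun r : ℝ => -(Real.exp (-(a * √(s ^ 2 + r ^ 2))) / (4 * Real.pi * a))) Filter.atTop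
        (nhds 0) := by
      have := ((Real.tendsto_exp_neg_atTop_nhds_zero.comp (ht.const_mul_atTop ha)).div_const
        (4 * Real.pi * a)).neg
      simpa [Function.comp_def] using this
    rw [integral_Ioi_of_hasDerivAt_of_nonneg' hd (fun r hr => ?_) hl]
    · simp [Real.sqrt_sq_eq_abs]
    · have hr0 : 0 < r := hr
      positivity
  rw [integral_fun_norm_addHaar (volume : Measure (EuclideanSpace ℝ (Fin 2)))
    (fun r => greenProfile a (√(s ^ 2 + r ^ 2)))]
  have e : ∀ r : ℝ, r ^ (Module.finrank ℝ (EuclideanSpace ℝ (Fin 2)) - 1) •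
      greenProfile a (√(s ^ 2 + r ^ 2)) = ((r * (Real.exp (-(a * √(s ^ 2 + r ^ 2))) /
      (4 * Real.pi * √(s ^ 2 + r ^ 2))) : ℝ) : ℂ) := by
    intro r
    simp only [finrank_euclideanSpace, Fintype.card_fin, greenProfile]
    rw [← Complex.coe_smul, smul_eq_mul, ← Complex.ofReal_mul]
    norm_num
  simp only [e]
  rw [integral_complex_ofReal, key]
  have hv : (volume : Measure (EuclideanSpace ℝ (Fin 2))).real (Metric.ball 0 1) = Real.pi := by
    rw [Measure.real, EuclideanSpace.volume_ball_fin_two]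
    simp [hpi.le]
  rw [hv, finrank_euclideanSpace, Fintype.card_fin, ← Complex.coe_smul, smul_eq_mul,
    nsmul_eq_mul, ← Complex.ofReal_mul]
  norm_cast
  field_simp
  norm_num

theorem integral_fourier_exp_neg_abs {a : ℝ} (ha : 0 < a) (k : ℝ) :
    ∫ s : ℝ, (Real.fourierChar (-(s * k)) : ℂ) * ((Real.exp (-(a * |s|)) / (2 * a) : ℝ) : ℂ) =
      ((1 / (4 * Real.pi ^ 2 * k ^ 2 + a ^ 2) : ℝ) : ℂ) := by
  let c1 : ℂ := -a - 2 * Real.pi * k * Complex.I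
  let c2 : ℂ := a - 2 * Real.pi * k * Complex.I
  have r1 : c1.re < 0 := by simp [c1, ha]
  have r2 : 0 < c2.re := by simp [c2, ha]
  have e1 : ∀ s ∈ Ioi (0 : ℝ), (Real.fourierChar (-(s * k)) : ℂ) *
      ((Real.exp (-(a * |s|)) / (2 * a) : ℝ) : ℂ) = Complex.exp (c1 * s) * (1 / (2 * a)) := by
    intro s hs
    rw [abs_of_pos hs, Real.fourierChar_apply]
    push_cast
    rw [mul_div_assoc', ← Complex.exp_add, mul_one_div]
    congr 2
    simp only [c1]
    ring
  have e2 : ∀ s ∈ Iic (0 : ℝ), (Real.fourierChar (-(s * k)) : ℂ) *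
      ((Real.exp (-(a * |s|)) / (2 * a) : ℝ) : ℂ) = Complex.exp (c2 * s) * (1 / (2 * a)) := by
    intro s hs
    rw [abs_of_nonpos hs, Real.fourierChar_apply]
    push_cast
    rw [mul_div_assoc', ← Complex.exp_add, mul_one_div]
    congr 2
    simp only [c2]
    ring
  have i1 : IntegrableOn (fun s : ℝ => Complex.exp (c1 * s) * (1 / (2 * a))) (Ioi 0) :=
    (integrableOn_exp_mul_complex_Ioi r1 0).mul_const _
  have i2 : IntegrableOn (fun s : ℝ => Complex.exp (c2 * s) * (1 / (2 * a))) (Iic 0) :=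
    (integrableOn_exp_mul_complex_Iic r2 0).mul_const _
  rw [← intervalIntegral.integral_Iic_add_Ioi (b := 0)
    (i2.congr_fun (fun s hs => (e2 s hs).symm) measurableSet_Iic)
    (i1.congr_fun (fun s hs => (e1 s hs).symm) measurableSet_Ioi),
    setIntegral_congr_fun measurableSet_Iic e2, setIntegral_congr_fun measurableSet_Ioi e1,
    integral_mul_const, integral_mul_const, integral_exp_mul_complex_Ioi r1,
    integral_exp_mul_complex_Iic r2]
  have n1 : c1 ≠ 0 := fun h => by rw [h] at r1; simp at r1
  have n2 : c2 ≠ 0 := fun h => by rw [h] at r2; simp at r2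
  have n3 : (4 * Real.pi ^ 2 * k ^ 2 + a ^ 2 : ℂ) = -(c1 * c2) := by
    simp only [c1, c2]
    linear_combination (2 * Real.pi * k : ℂ) ^ 2 * Complex.I_sq
  have n4 : c2 - c1 = 2 * a := by simp only [c1, c2]; ring
  have n5 : (2 * a : ℂ) ≠ 0 := by exact_mod_cast (by positivity : 2 * a ≠ 0)
  push_cast
  rw [n3, ← n4]
  rw [← n4] at n5
  simp only [mul_zero, Complex.exp_zero]
  field_simp
  ring

/-- By radial symmetry ξ may be moved to the first axis of ℝ × ℝ². Fubini then leaves the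
one-dimensional transform of the plane integrals. -/
theorem fourier_green {lam : ℝ} (hlam : 0 < lam) (ξ : E3) :
    𝓕 (green lam) ξ = ((1 / (4 * Real.pi ^ 2 * ‖ξ‖ ^ 2 + lam) : ℝ) : ℂ) := by
  let V := WithLp 2 (ℝ × EuclideanSpace ℝ (Fin 2))
  have hfr : Module.finrank ℝ V = Module.finrank ℝ E3 := by
    rw [(WithLp.linearEquiv 2 ℝ (ℝ × EuclideanSpace ℝ (Fin 2))).finrank_eq]
    simp
  let A : V ≃ₗᵢ[ℝ] E3 :=
    (stdOrthonormalBasis ℝ V).equiv (stdOrthonormalBasis ℝ E3) (finCongr hfr)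
  let w : V := WithLp.toLp 2 (‖ξ‖, 0)
  have hw : ‖w‖ = ‖ξ‖ := by
    rw [WithLp.prod_norm_eq_of_L2]
    simp [w]
  -- Two vectors of equal norm are exchanged by the reflection in the hyperplane orthogonal to their
  -- difference.
  let B : E3 ≃ₗᵢ[ℝ] E3 := (Submodule.span ℝ {A w - ξ})ᗮ.reflection
  have hB : B (A w) = ξ := Submodule.reflection_sub (by rw [A.norm_map, hw])
  have hrad : green lam ∘ (A.trans B) = fun v : V => greenProfile (√lam) ‖v‖ := by
    ext v
    rw [Function.comp_apply, green_eq_profile, LinearIsometryEquiv.norm_map]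
  have h1 : 𝓕 (green lam) ξ = 𝓕 (fun v : V => greenProfile (√lam) ‖v‖) w := by
    rw [← hrad, Real.fourier_comp_linearIsometry]
    exact congrArg _ hB.symm
  have hint : Integrable (fun v : V => greenProfile (√lam) ‖v‖) := by
    rw [← hrad]
    exact ((A.trans B).measurePreserving.integrable_comp_emb
      (A.trans B).toHomeomorph.measurableEmbedding).2 (integrable_green hlam)
  have hs := Real.sqrt_pos.2 hlam
  have hmp : MeasurePreserving (WithLp.toLp 2 : ℝ × EuclideanSpace ℝ (Fin 2) → V) :=
    WithLp.volume_preserving_toLp ℝ (EuclideanSpace ℝ (Fin 2))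
  have hemb : MeasurableEmbedding (WithLp.toLp 2 : ℝ × EuclideanSpace ℝ (Fin 2) → V) :=
    (MeasurableEquiv.toLp 2 (ℝ × EuclideanSpace ℝ (Fin 2))).measurableEmbedding
  have hint2 : Integrable (fun v : V => Real.fourierChar (-inner ℝ v w) • greenProfile (√lam) ‖v‖) :=
    (Real.fourierIntegral_convergent_iff w).2 hint
  have hprod := (hmp.integrable_comp_emb hemb).2 hint2
  rw [h1, Real.fourier_eq, ← hmp.integral_comp hemb]
  have e : ∀ p : ℝ × EuclideanSpace ℝ (Fin 2),
      Real.fourierChar (-inner ℝ (WithLp.toLp 2 p : V) w) •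
        greenProfile (√lam) ‖(WithLp.toLp 2 p : V)‖ =
      (Real.fourierChar (-(p.1 * ‖ξ‖)) : ℂ) * greenProfile (√lam) (√(p.1 ^ 2 + ‖p.2‖ ^ 2)) := by
    intro p
    rw [WithLp.prod_norm_eq_of_L2, WithLp.prod_inner_apply]
    simp [w, Circle.smul_def, mul_comm]
  simp only [Function.comp_def, e] at hprod
  simp only [e]
  rw [Measure.volume_eq_prod] at hprod ⊢
  rw [integral_prod _ hprod]
  simp only [integral_const_mul]
  have e2 : ∀ᵐ s : ℝ, (Real.fourierChar (-(s * ‖ξ‖)) : ℂ) *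
      ∫ y : EuclideanSpace ℝ (Fin 2), greenProfile (√lam) (√(s ^ 2 + ‖y‖ ^ 2)) =
      (Real.fourierChar (-(s * ‖ξ‖)) : ℂ) *
        ((Real.exp (-(√lam * |s|)) / (2 * √lam) : ℝ) : ℂ) := by
    filter_upwards [Measure.ae_ne volume (0 : ℝ)] with s hs0
    rw [integral_planar_profile hs hs0]
  rw [integral_congr_ae e2, integral_fourier_exp_neg_abs hs, Real.sq_sqrt hlam.le]

theorem integral_green_mul_green {a b : ℝ} (ha : 0 < a) (hb : 0 < b) :
    ∫ x : E3, green a x * green b x = ((1 / (4 * Real.pi * (√a + √b)) : ℝ) : ℂ) := by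
  have hpi := Real.pi_pos
  have sa := Real.sqrt_pos.2 ha
  have sb := Real.sqrt_pos.2 hb
  simp only [green_eq_profile]
  rw [integral_fun_norm_addHaar (volume : Measure E3)
    (fun r => greenProfile (√a) r * greenProfile (√b) r)]
  have e : ∀ r ∈ Ioi (0 : ℝ), r ^ (Module.finrank ℝ E3 - 1) •
      (greenProfile (√a) r * greenProfile (√b) r) =
      ((1 / (4 * Real.pi) ^ 2 * Real.exp (-(√a + √b) * r) : ℝ) : ℂ) := by
    intro r hr
    have hr0 : r ≠ 0 := ne_of_gt hr
    have hexp : Real.exp (-(√a + √b) * r) = Real.exp (-(√a * r)) * Real.exp (-(√b * r)) := by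
      rw [← Real.exp_add]; ring_nf
    simp only [finrank_euclideanSpace, Fintype.card_fin, greenProfile]
    rw [← Complex.coe_smul, smul_eq_mul, ← Complex.ofReal_mul, ← Complex.ofReal_mul, hexp]
    congr 1
    field_simp
  rw [setIntegral_congr_fun measurableSet_Ioi e, integral_complex_ofReal, integral_const_mul,
    integral_exp_mul_Ioi (by linarith) 0]
  have hv : (volume : Measure E3).real (Metric.ball 0 1) = Real.pi * 4 / 3 := by
    rw [Measure.real, EuclideanSpace.volume_ball_fin_three]
    simp
    positivity
  rw [hv, finrank_euclideanSpace, Fintype.card_fin, ← Complex.coe_smul, smul_eq_mul,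
    nsmul_eq_mul, ← Complex.ofReal_mul]
  norm_cast
  rw [mul_zero, Real.exp_zero]
  field_simp

/-! ### Tempered distributions and the Fourier transform of `L²` functions -/

theorem ae_eq_of_integral_schwartz_mul_eq {f g : E3 → ℂ}
    (hf : LocallyIntegrable f) (hg : LocallyIntegrable g)
    (h : ∀ φ : 𝓢(E3, ℂ), ∫ x, φ x * f x = ∫ x, φ x * g x) : f =ᵐ[volume] g := by
  refine ae_eq_of_integral_contDiff_smul_eq hf hg fun φ hφ hφc => ?_
  have h1 : HasCompactSupport (Complex.ofRealCLM ∘ φ) := hφc.comp_left rfl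
  have h2 : ContDiff ℝ ((⊤ : ℕ∞) : WithTop ℕ∞) (Complex.ofRealCLM ∘ φ) := by fun_prop
  simpa using h (h1.toSchwartzMap h2)

theorem toDist_apply (f : L2) (φ : 𝓢(E3, ℂ)) : toDist f φ = ∫ x, φ x * f x := by
  simp [toDist, Lp.toTemperedDistribution_apply]

theorem locallyIntegrable_L2 (f : L2) : LocallyIntegrable (f : E3 → ℂ) :=
  (Lp.memLp f).locallyIntegrable one_le_two

/-- The bridge from identities between tempered distributions to almost everywhere identities of L²
functions. -/
theorem smulLeftCLM_toDist_eq_iff {g : E3 → ℂ} (hg : g.HasTemperateGrowth) {f u : L2} :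
    TemperedDistribution.smulLeftCLM ℂ g (toDist f) = toDist u ↔
      (u : E3 → ℂ) =ᵐ[volume] fun x => g x * f x := by
  have e (φ : 𝓢(E3, ℂ)) : TemperedDistribution.smulLeftCLM ℂ g (toDist f) φ =
      ∫ x, φ x * (g x * f x) := by
    rw [TemperedDistribution.smulLeftCLM_apply_apply, toDist_apply]
    refine integral_congr_ae (.of_forall fun x => ?_)
    simp only [SchwartzMap.smulLeftCLM_apply_apply hg, smul_eq_mul]
    ring
  constructor
  · intro h
    refine ae_eq_of_integral_schwartz_mul_eq (locallyIntegrable_L2 u) ?_ fun φ => ?_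
    · exact locallyIntegrable_iff.2 fun k hk =>
      ((locallyIntegrable_L2 f).integrableOn_isCompact hk).continuousOn_mul
          hg.1.continuous.continuousOn hk
    · rw [← e, h, toDist_apply]
  · intro h
    ext φ
    rw [e, toDist_apply]
    refine integral_congr_ae ?_
    filter_upwards [h] with x hx
    rw [hx]

theorem fourier_toDist (f : L2) : 𝓕 (toDist f) = toDist (𝓕 f) :=
  Lp.fourier_toTemperedDistribution_eq f

theorem fourierInv_toDist (f : L2) : 𝓕⁻ (toDist f) = toDist (𝓕⁻ f) :=
  Lp.fourierInv_toTemperedDistribution_eq f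

theorem toDist_eq_fourierMultiplierCLM_iff {g : E3 → ℂ} (hg : g.HasTemperateGrowth) {f u : L2} :
    toDist u = TemperedDistribution.fourierMultiplierCLM ℂ g (toDist f) ↔
      (𝓕 u : L2) =ᵐ[volume] fun ξ => g ξ * (𝓕 f : L2) ξ := by
  rw [← smulLeftCLM_toDist_eq_iff hg, TemperedDistribution.fourierMultiplierCLM_apply,
    fourier_toDist, ← fourier_toDist u]
  constructor
  · intro h
    rw [h, FourierTransform.fourier_fourierInv_eq]
  · intro h
    rw [h, FourierTransform.fourierInv_fourier_eq]

theorem mem_sobolev_iff {s : ℝ} {f : L2} : f ∈ sobolev s ↔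
    ∃ u : L2, (u : E3 → ℂ) =ᵐ[volume]
      fun ξ => (((1 + ‖ξ‖ ^ 2) ^ (s / 2) : ℝ) : ℂ) * (𝓕 f : L2) ξ := by
  change TemperedDistribution.MemSobolev s 2 (toDist f) ↔ _
  rw [TemperedDistribution.memSobolev_iff_exists_smulLeftCLM_fourier, fourier_toDist]
  refine exists_congr fun u => ?_
  rw [← smulLeftCLM_toDist_eq_iff (by fun_prop)]
  rfl

theorem continuous_fourier_of_integrable {f : E3 → ℂ} (hf : Integrable f) : Continuous (𝓕 f) :=
  VectorFourier.fourierIntegral_continuous Real.continuous_fourierChar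
    (L := innerₗ E3) continuous_inner hf

theorem continuous_fourierInv_of_integrable {f : E3 → ℂ} (hf : Integrable f) :
    Continuous (𝓕⁻ f) := by
  have : (𝓕⁻ f : E3 → ℂ) = fun x => 𝓕 f (-x) := funext fun x => Real.fourierInv_eq_fourier_neg f x
  rw [this]
  exact (continuous_fourier_of_integrable hf).comp continuous_neg

theorem integral_schwartz_mul_toLp {f : E3 → ℂ} (h2 : MemLp f 2) (φ : 𝓢(E3, ℂ)) :
    ∫ x, φ x * (h2.toLp f : E3 → ℂ) x = ∫ x, φ x * f x := by
  refine integral_congr_ae ?_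
  filter_upwards [h2.coeFn_toLp] with x hx
  rw [hx]

/-- On L¹ ∩ L² the Plancherel transform is the Fourier integral: both satisfy the same duality with
Schwartz functions. -/
theorem fourier_toLp_ae_eq {f : E3 → ℂ} (h1 : Integrable f) (h2 : MemLp f 2) :
    (𝓕 (h2.toLp f) : L2) =ᵐ[volume] 𝓕 f := by
  refine ae_eq_of_integral_schwartz_mul_eq (locallyIntegrable_L2 _) ?_ fun φ => ?_
  · exact (continuous_fourier_of_integrable h1).locallyIntegrable
  · rw [← toDist_apply, ← fourier_toDist, TemperedDistribution.fourier_apply, toDist_apply,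
      integral_schwartz_mul_toLp]
    have := VectorFourier.integral_fourierIntegral_smul_eq_flip (L := innerₗ E3)
      (μ := volume) (ν := volume) Real.continuous_fourierChar
      continuous_inner φ.integrable h1
    rw [flip_innerₗ] at this
    exact this

theorem fourierInv_toLp_ae_eq {f : E3 → ℂ} (h1 : Integrable f) (h2 : MemLp f 2) :
    (𝓕⁻ (h2.toLp f) : L2) =ᵐ[volume] 𝓕⁻ f := by
  have e (g : E3 → ℂ) : 𝓕⁻ g = VectorFourier.fourierIntegral Real.fourierChar volume
      (-innerₗ E3) g := by
    funext x
    simp [Real.fourierInv_eq, VectorFourier.fourierIntegral]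
  refine ae_eq_of_integral_schwartz_mul_eq (locallyIntegrable_L2 _) ?_ fun φ => ?_
  · exact (continuous_fourierInv_of_integrable h1).locallyIntegrable
  · rw [← toDist_apply, ← fourierInv_toDist, TemperedDistribution.fourierInv_apply, toDist_apply,
      integral_schwartz_mul_toLp]
    have := VectorFourier.integral_fourierIntegral_smul_eq_flip (L := -innerₗ E3)
      (μ := volume) (ν := volume) Real.continuous_fourierChar
      continuous_inner.neg φ.integrable h1
    have hflip : (-innerₗ E3).flip = -innerₗ E3 := by
      ext x y
      simp [real_inner_comm]
    rw [hflip, ← e, ← e, ← SchwartzMap.fourierInv_coe] at this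
    exact this

/-! ### Bounded Fourier multipliers on `L²` -/

open scoped Classical in
/-- Multiplication by the bounded real function `m` on `L²(ℝ³)` (`0` if `m` is not bounded). -/
def mulOp (m : E3 → ℝ) : L2 →L[ℂ] L2 :=
  if h : MemLp (fun x => (m x : ℂ)) ⊤ (volume : Measure E3) then
    (ContinuousLinearMap.mul ℂ ℂ).holderL volume ⊤ 2 2 (h.toLp _) else 0

/-- The Fourier multiplier with symbol `m` on `L²(ℝ³)`. -/
def fourierOp (m : E3 → ℝ) : L2 →L[ℂ] L2 :=
  ((Lp.fourierTransformₗᵢ E3 ℂ).symm : L2 →L[ℂ] L2) ∘L mulOp m ∘L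
    ((Lp.fourierTransformₗᵢ E3 ℂ) : L2 →L[ℂ] L2)

theorem memLp_top_of_bound {m : E3 → ℝ} (hm : Measurable m) {C : ℝ} (h : ∀ x, |m x| ≤ C) :
    MemLp (fun x => (m x : ℂ)) ⊤ (volume : Measure E3) :=
  MeasureTheory.memLp_top_of_bound (by fun_prop : Measurable fun x => (m x : ℂ)).aestronglyMeasurable C
    (.of_forall fun x => by simpa using h x)

variable {m n : E3 → ℝ}

theorem mulOp_ae_eq (hm : MemLp (fun x => (m x : ℂ)) ⊤ (volume : Measure E3)) (f : L2) :
    (mulOp m f : E3 → ℂ) =ᵐ[volume] fun x => m x * f x := by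
  rw [mulOp, dif_pos hm]
  refine (ContinuousLinearMap.coeFn_holder _ _ _).trans ?_
  filter_upwards [hm.coeFn_toLp] with x hx
  simp [hx]

theorem fourier_fourierOp (m : E3 → ℝ) (f : L2) : (𝓕 (fourierOp m f) : L2) = mulOp m (𝓕 f) :=
  (Lp.fourierTransformₗᵢ E3 ℂ).apply_symm_apply _

theorem fourier_fourierOp_ae_eq (hm : MemLp (fun x => (m x : ℂ)) ⊤ (volume : Measure E3))
    (f : L2) : (𝓕 (fourierOp m f) : L2) =ᵐ[volume] fun ξ => m ξ * (𝓕 f : L2) ξ := by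
  rw [fourier_fourierOp]
  exact mulOp_ae_eq hm _

theorem fourier_injective : Function.Injective (𝓕 : L2 → L2) :=
  (Lp.fourierTransformₗᵢ E3 ℂ).injective

theorem fourierOp_eq_iff (hm : MemLp (fun x => (m x : ℂ)) ⊤ (volume : Measure E3)) {f u : L2} :
    fourierOp m f = u ↔ (𝓕 u : L2) =ᵐ[volume] fun ξ => m ξ * (𝓕 f : L2) ξ := by
  rw [← fourier_injective.eq_iff, Lp.ext_iff]
  have := fourier_fourierOp_ae_eq hm f
  exact ⟨fun h => h.symm.trans this, fun h => this.trans h.symm⟩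

theorem fourierOp_fourierOp (hm : MemLp (fun x => (m x : ℂ)) ⊤ (volume : Measure E3))
    (hn : MemLp (fun x => (n x : ℂ)) ⊤ (volume : Measure E3))
    (hmn : MemLp (fun x => ((m x * n x : ℝ) : ℂ)) ⊤ (volume : Measure E3)) :
    fourierOp m * fourierOp n = fourierOp fun ξ => m ξ * n ξ := by
  ext1 f
  symm
  rw [fourierOp_eq_iff hmn]
  filter_upwards [fourier_fourierOp_ae_eq hm (fourierOp n f), fourier_fourierOp_ae_eq hn f]
    with ξ h1 h2
  simp only [mul_apply_eq_comp, h1, h2]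
  push_cast
  ring

theorem fourierOp_injective (hm : MemLp (fun x => (m x : ℂ)) ⊤ (volume : Measure E3))
    (h0 : ∀ ξ, m ξ ≠ 0) : Function.Injective (fourierOp m) := by
  refine (injective_iff_map_eq_zero _).2 fun f hf => ?_
  rw [fourierOp_eq_iff hm] at hf
  refine fourier_injective ?_
  rw [FourierTransform.fourier_zero] at hf ⊢
  refine Lp.ext ?_
  filter_upwards [hf, Lp.coeFn_zero ℂ 2 (volume : Measure E3)] with ξ h1 h2
  rw [h2] at h1 ⊢
  have : (m ξ : ℂ) ≠ 0 := by exact_mod_cast h0 ξ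
  simpa [this] using h1.symm

theorem inner_eq_integral (f g : L2) : inner ℂ f g = ∫ x, (starRingEnd ℂ) (f x) * g x := by
  rw [L2.inner_def]
  refine integral_congr_ae (.of_forall fun x => ?_)
  simp [mul_comm]

theorem fourierOp_nonneg (hm : MemLp (fun x => (m x : ℂ)) ⊤ (volume : Measure E3))
    (h0 : ∀ ξ, 0 ≤ m ξ) : 0 ≤ fourierOp m := by
  rw [ContinuousLinearMap.nonneg_iff_isPositive, ContinuousLinearMap.isPositive_iff_complex]
  intro f
  have : inner ℂ (fourierOp m f) f =
      ((∫ ξ, m ξ * ‖(𝓕 f : L2) ξ‖ ^ 2 : ℝ) : ℂ) := by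
    rw [← Lp.inner_fourier_eq, inner_eq_integral, ← integral_complex_ofReal]
    refine integral_congr_ae ?_
    filter_upwards [fourier_fourierOp_ae_eq hm f] with ξ h
    rw [h, map_mul, Complex.conj_ofReal, mul_assoc, Complex.conj_mul']
    push_cast
    rfl
  rw [this]
  refine ⟨by simp, ?_⟩
  simp only [RCLike.re_to_complex, Complex.ofReal_re]
  exact integral_nonneg fun ξ => mul_nonneg (h0 ξ) (by positivity)

section

variable {H : Type*} [NormedAddCommGroup H] [InnerProductSpace ℂ H] [CompleteSpace H]

/-- The operator `A ^ (1 / 4)`. -/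
abbrev fourthRoot (A : H →L[ℂ] H) : H →L[ℂ] H := A ^ (1 / 4 : ℝ)

theorem fourthRoot_eq {A B C : H →L[ℂ] H} (hB : 0 ≤ B) (hC : 0 ≤ C) (hBA : B * B = A)
    (hCB : C * C = B) : fourthRoot A = C := by
  have hA : 0 ≤ A := by
    rw [← hBA]
    simpa using (IsSelfAdjoint.of_nonneg hB).mul_self_nonneg
  rw [fourthRoot, quarter_rpow hA, ← CFC.sqrt_eq_rpow, ← CFC.sqrt_eq_rpow,
    CFC.sqrt_unique hBA hB, CFC.sqrt_unique hCB hC]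

end

/-! ### The free resolvent and its powers -/

/-- The symbol `|p|² + a` of `-Δ + a`, with `p = 2πξ`. -/
def symbol (a : ℝ) (ξ : E3) : ℝ := 4 * Real.pi ^ 2 * ‖ξ‖ ^ 2 + a

/-- The operator `(-Δ + a) ^ (-r)`. -/
def besselOp (a r : ℝ) : L2 →L[ℂ] L2 := fourierOp fun ξ => symbol a ξ ^ (-r)

/-- The Green function `G_a` as an element of `L²(ℝ³)` (`0` if `a ≤ 0`). -/
def greenVec (a : ℝ) : L2 := if h : 0 < a then greenL2 h else 0

theorem measurable_symbol (a : ℝ) : Measurable (symbol a) := by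
  unfold symbol
  fun_prop

theorem le_symbol (a : ℝ) (ξ : E3) : a ≤ symbol a ξ := by
  unfold symbol
  have : 0 ≤ 4 * Real.pi ^ 2 * ‖ξ‖ ^ 2 := by positivity
  linarith

section

variable {a : ℝ} (ha : 0 < a)
include ha

theorem symbol_pos (ξ : E3) : 0 < symbol a ξ := ha.trans_le (le_symbol a ξ)

theorem memLp_top_symbol_rpow {r : ℝ} (hr : 0 ≤ r) :
    MemLp (fun ξ : E3 => ((symbol a ξ ^ (-r) : ℝ) : ℂ)) ⊤ (volume : Measure E3) := by
  refine memLp_top_of_bound (C := a ^ (-r)) ((measurable_symbol a).pow_const _) fun ξ => ?_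
  rw [abs_of_nonneg (Real.rpow_nonneg (symbol_pos ha ξ).le _)]
  exact Real.rpow_le_rpow_of_nonpos ha (le_symbol a ξ) (by linarith)

theorem fourier_besselOp {r : ℝ} (hr : 0 ≤ r) (f : L2) : (𝓕 (besselOp a r f) : L2) =ᵐ[volume]
    fun ξ => ((symbol a ξ ^ (-r) : ℝ) : ℂ) * (𝓕 f : L2) ξ :=
  fourier_fourierOp_ae_eq (memLp_top_symbol_rpow ha hr) f

theorem besselOp_eq_iff {r : ℝ} (hr : 0 ≤ r) {f u : L2} : besselOp a r f = u ↔
    (𝓕 u : L2) =ᵐ[volume] fun ξ => ((symbol a ξ ^ (-r) : ℝ) : ℂ) * (𝓕 f : L2) ξ :=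
  fourierOp_eq_iff (memLp_top_symbol_rpow ha hr)

theorem besselOp_mul {r s : ℝ} (hr : 0 ≤ r) (hs : 0 ≤ s) :
    besselOp a r * besselOp a s = besselOp a (r + s) := by
  have e : (fun ξ : E3 => symbol a ξ ^ (-r) * symbol a ξ ^ (-s)) =
      fun ξ => symbol a ξ ^ (-(r + s)) := by
    funext ξ
    rw [← Real.rpow_add (symbol_pos ha ξ)]
    ring_nf
  unfold besselOp
  rw [fourierOp_fourierOp (memLp_top_symbol_rpow ha hr) (memLp_top_symbol_rpow ha hs) ?_, e]
  have := memLp_top_symbol_rpow ha (add_nonneg hr hs)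
  simp only [← congrFun e] at this
  exact this

theorem besselOp_nonneg {r : ℝ} (hr : 0 ≤ r) : 0 ≤ besselOp a r :=
  fourierOp_nonneg (memLp_top_symbol_rpow ha hr)
    fun ξ => Real.rpow_nonneg (symbol_pos ha ξ).le _

theorem besselOp_injective {r : ℝ} (hr : 0 ≤ r) : Function.Injective (besselOp a r) :=
  fourierOp_injective (memLp_top_symbol_rpow ha hr)
    fun ξ => (Real.rpow_pos_of_pos (symbol_pos ha ξ) _).ne'

theorem besselOp_quarter : fourthRoot (besselOp a 1) = besselOp a (1 / 4) := by
  refine fourthRoot_eq (B := besselOp a (1 / 2)) (besselOp_nonneg ha (by norm_num))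
    (besselOp_nonneg ha (by norm_num)) ?_ ?_
  · rw [besselOp_mul ha (by norm_num) (by norm_num)]
    norm_num
  · rw [besselOp_mul ha (by norm_num) (by norm_num)]
    norm_num

theorem greenVec_ae_eq : (greenVec a : E3 → ℂ) =ᵐ[volume] green a := by
  rw [greenVec, dif_pos ha]
  exact (memLp_green ha).coeFn_toLp

theorem greenVec_eq : greenVec a = greenL2 ha := dif_pos ha

theorem fourier_greenVec : (𝓕 (greenVec a) : L2) =ᵐ[volume]
    fun ξ => ((symbol a ξ ^ (-1 : ℝ) : ℝ) : ℂ) := by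
  rw [greenVec_eq ha]
  refine (fourier_toLp_ae_eq (integrable_green ha) (memLp_green ha)).trans (.of_forall fun ξ => ?_)
  simp only [fourier_green ha, Real.rpow_neg_one, symbol, one_div]

theorem inner_greenVec (f : L2) : inner ℂ (greenVec a) f = ∫ y, green a y * f y := by
  rw [inner_eq_integral]
  refine integral_congr_ae ?_
  filter_upwards [greenVec_ae_eq ha] with y hy
  rw [hy, green, Complex.conj_ofReal]

end

theorem symbol_sub (a b : ℝ) (ξ : E3) : symbol a ξ - symbol b ξ = a - b := by
  unfold symbol
  ring

theorem isResolventFamily_besselOp : IsResolventFamily fun a => besselOp a 1 where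
  nonneg a ha := besselOp_nonneg ha zero_le_one
  injective a ha := besselOp_injective ha zero_le_one
  sub_eq a b ha hb := by
    ext1 f
    rw [sub_apply, sub_eq_iff_eq_add, besselOp_eq_iff ha zero_le_one, FourierTransform.fourier_add,
      smul_apply, ← Complex.coe_smul, FourierTransform.fourier_smul]
    refine (Lp.coeFn_add _ _).trans ?_
    filter_upwards [Lp.coeFn_smul ((b - a : ℝ) : ℂ) (𝓕 ((besselOp a 1 * besselOp b 1) f) : L2),
      fourier_besselOp hb zero_le_one f,
      fourier_besselOp ha zero_le_one (besselOp b 1 f)] with ξ h1 h2 h3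
    rw [mul_apply_eq_comp] at h1
    rw [Pi.add_apply, mul_apply_eq_comp, h1, Pi.smul_apply, h2, h3, h2, smul_eq_mul,
      ← symbol_sub b a ξ]
    have p1 : (symbol a ξ : ℂ) ≠ 0 := by exact_mod_cast (symbol_pos ha ξ).ne'
    have p2 : (symbol b ξ : ℂ) ≠ 0 := by exact_mod_cast (symbol_pos hb ξ).ne'
    simp only [Real.rpow_neg_one]
    push_cast
    field_simp
    ring

theorem isGreenFamily_greenVec : IsGreenFamily (fun a => besselOp a 1) greenVec where
  resolvent := isResolventFamily_besselOp
  sub_eq a b ha hb := by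
    refine fourier_injective (Lp.ext ?_)
    rw [sub_eq_add_neg, ← neg_one_smul ℂ (greenVec b), FourierTransform.fourier_add,
      FourierTransform.fourier_smul, FourierTransform.fourier_smul]
    refine (Lp.coeFn_add _ _).trans ?_
    filter_upwards [Lp.coeFn_smul (-1 : ℂ) (𝓕 (greenVec b) : L2),
      Lp.coeFn_smul ((b - a : ℝ) : ℂ) (𝓕 (besselOp a 1 (greenVec b)) : L2),
      fourier_besselOp ha zero_le_one (greenVec b), fourier_greenVec ha, fourier_greenVec hb]
      with ξ h1 h2 h3 h4 h5
    rw [Pi.add_apply, h1, h2, Pi.smul_apply, Pi.smul_apply, h3, h4, h5, smul_eq_mul, smul_eq_mul,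
      ← symbol_sub b a ξ]
    have p1 : (symbol a ξ : ℂ) ≠ 0 := by exact_mod_cast (symbol_pos ha ξ).ne'
    have p2 : (symbol b ξ : ℂ) ≠ 0 := by exact_mod_cast (symbol_pos hb ξ).ne'
    simp only [Real.rpow_neg_one]
    push_cast
    field_simp
    ring
  inner_eq a b ha hb := by
    rw [inner_greenVec ha, ← integral_green_mul_green ha hb]
    refine integral_congr_ae ?_
    filter_upwards [greenVec_ae_eq hb] with y hy
    rw [hy]

/-! ### Sobolev spaces as ranges of powers of the free resolvent -/

theorem sobolev_mono {s t : ℝ} (h : s ≤ t) : sobolev t ≤ sobolev s :=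
  fun _ hf => TemperedDistribution.MemSobolev.mono h hf

theorem symbol_le {a : ℝ} (ha : 0 < a) (ξ : E3) :
    symbol a ξ ≤ (4 * Real.pi ^ 2 + a) * (1 + ‖ξ‖ ^ 2) := by
  unfold symbol
  nlinarith [sq_nonneg Real.pi, sq_nonneg ‖ξ‖, mul_nonneg ha.le (sq_nonneg ‖ξ‖)]

theorem le_symbol_mul {a : ℝ} (ha : 0 < a) (ξ : E3) :
    1 + ‖ξ‖ ^ 2 ≤ (1 / a + 1 / (4 * Real.pi ^ 2)) * symbol a ξ := by
  unfold symbol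
  have hp : 0 < 4 * Real.pi ^ 2 := by positivity
  have : (1 / a + 1 / (4 * Real.pi ^ 2)) * (4 * Real.pi ^ 2 * ‖ξ‖ ^ 2 + a) =
      1 + ‖ξ‖ ^ 2 + (4 * Real.pi ^ 2 * ‖ξ‖ ^ 2 / a + a / (4 * Real.pi ^ 2)) := by
    field_simp
    ring
  rw [this]
  have : 0 ≤ 4 * Real.pi ^ 2 * ‖ξ‖ ^ 2 / a + a / (4 * Real.pi ^ 2) := by positivity
  linarith

/-- The weights 1 + |ξ|² and |2πξ|² + a are comparable, so the powers of their quotients, in both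
directions, are bounded multipliers. -/
theorem sobolev_eq_range {a s : ℝ} (ha : 0 < a) (hs : 0 ≤ s) :
    sobolev s = (besselOp a (s / 2)).range := by
  have hs2 : 0 ≤ s / 2 := by linarith
  have hj (ξ : E3) : 0 < 1 + ‖ξ‖ ^ 2 := by positivity
  have bound (m n : E3 → ℝ) (hm : Measurable m) (hn : Measurable n) (hm0 : ∀ ξ, 0 < m ξ)
      (hn0 : ∀ ξ, 0 < n ξ) (C : ℝ) (hC : ∀ ξ, m ξ ≤ C * n ξ) :
      MemLp (fun ξ => (((m ξ / n ξ) ^ (s / 2) : ℝ) : ℂ)) ⊤ (volume : Measure E3) := by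
    refine memLp_top_of_bound (C := C ^ (s / 2)) ((hm.div hn).pow_const _) fun ξ => ?_
    have h := div_pos (hm0 ξ) (hn0 ξ)
    rw [abs_of_nonneg (Real.rpow_nonneg h.le _)]
    exact Real.rpow_le_rpow h.le ((div_le_iff₀ (hn0 ξ)).2 (hC ξ)) hs2
  have hjm : Measurable fun ξ : E3 => 1 + ‖ξ‖ ^ 2 := by fun_prop
  have b1 := bound _ _ (measurable_symbol a) hjm (symbol_pos ha) hj _ (symbol_le ha)
  have b2 := bound _ _ hjm (measurable_symbol a) hj (symbol_pos ha) _ (le_symbol_mul ha)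
  ext f
  rw [mem_sobolev_iff]
  constructor
  · rintro ⟨u, hu⟩
    refine ⟨𝓕⁻ (mulOp (fun ξ => (symbol a ξ / (1 + ‖ξ‖ ^ 2)) ^ (s / 2)) u), ?_⟩
    refine (besselOp_eq_iff ha hs2).2 ?_
    rw [FourierTransform.fourier_fourierInv_eq]
    filter_upwards [hu, mulOp_ae_eq b1 u] with ξ h1 h2
    have p1 := Real.rpow_pos_of_pos (symbol_pos ha ξ) (s / 2)
    have p2 := Real.rpow_pos_of_pos (hj ξ) (s / 2)
    rw [h2, h1, ← mul_assoc, ← mul_assoc, ← Complex.ofReal_mul, ← Complex.ofReal_mul,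
      Real.div_rpow (symbol_pos ha ξ).le (hj ξ).le, Real.rpow_neg (symbol_pos ha ξ).le]
    field_simp
    simp
  · rintro ⟨v, hv⟩
    refine ⟨mulOp (fun ξ => ((1 + ‖ξ‖ ^ 2) / symbol a ξ) ^ (s / 2)) (𝓕 v), ?_⟩
    filter_upwards [(besselOp_eq_iff ha hs2).1 hv, mulOp_ae_eq b2 (𝓕 v)] with ξ h1 h2
    rw [h2, h1, ← mul_assoc, ← Complex.ofReal_mul,
      Real.div_rpow (hj ξ).le (symbol_pos ha ξ).le, Real.rpow_neg (symbol_pos ha ξ).le,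
      div_eq_mul_inv]

theorem hasTemperateGrowth_symbol_rpow {a : ℝ} (ha : 0 < a) (r : ℝ) :
    (fun ξ : E3 => ((symbol a ξ ^ r : ℝ) : ℂ)).HasTemperateGrowth := by
  have hp := Real.sqrt_pos.2 ha
  -- A dilation by 2π/√a reduces the symbol to the standard weight 1 + |ξ|².
  have e : (fun ξ : E3 => ((symbol a ξ ^ r : ℝ) : ℂ)) = fun ξ : E3 => ((a ^ r : ℝ) : ℂ) *
      (((1 + ‖((2 * Real.pi / √a) • ContinuousLinearMap.id ℝ E3) ξ‖ ^ 2) ^ r : ℝ) : ℂ) := by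
    funext ξ
    rw [← Complex.ofReal_mul, ← Real.mul_rpow ha.le (by positivity)]
    congr 2
    simp only [smul_apply, ContinuousLinearMap.id_apply, norm_smul, Real.norm_eq_abs, mul_pow,
      sq_abs, div_pow, Real.sq_sqrt ha.le, symbol]
    field_simp
    ring
  rw [e]
  refine (Function.HasTemperateGrowth.const _).mul ?_
  exact (by fun_prop : (fun ξ : E3 =>
    (((1 + ‖ξ‖ ^ 2) ^ r : ℝ) : ℂ)).HasTemperateGrowth).comp
      (ContinuousLinearMap.hasTemperateGrowth _)

theorem freePower_besselOp {a s : ℝ} (ha : 0 < a) (hs : 0 ≤ s) (v : L2) :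
    freePower a s (besselOp a (s / 2) v) = v := by
  have key (u : L2) : toDist u = TemperedDistribution.fourierMultiplierCLM ℂ
      (fun ξ : E3 => (((4 * Real.pi ^ 2 * ‖ξ‖ ^ 2 + a) ^ (s / 2) : ℝ) : ℂ))
      (toDist (besselOp a (s / 2) v)) ↔ u = v := by
    refine (toDist_eq_fourierMultiplierCLM_iff (hasTemperateGrowth_symbol_rpow ha (s / 2))).trans ?_
    rw [← fourier_injective.eq_iff, Lp.ext_iff]
    have : (fun ξ : E3 => (((symbol a ξ) ^ (s / 2) : ℝ) : ℂ) *
        (𝓕 (besselOp a (s / 2) v) : L2) ξ) =ᵐ[volume] (𝓕 v : L2) := by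
      filter_upwards [fourier_besselOp ha (by linarith : 0 ≤ s / 2) v] with ξ h
      rw [h, ← mul_assoc, ← Complex.ofReal_mul, ← Real.rpow_add (symbol_pos ha ξ)]
      simp
    exact ⟨fun h => h.trans this, fun h => h.trans this.symm⟩
  have hex : ∃ u : L2, toDist u = TemperedDistribution.fourierMultiplierCLM ℂ
      (fun ξ : E3 => (((4 * Real.pi ^ 2 * ‖ξ‖ ^ 2 + a) ^ (s / 2) : ℝ) : ℂ))
      (toDist (besselOp a (s / 2) v)) := ⟨v, (key v).2 rfl⟩
  rw [freePower, dif_pos hex]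
  exact (key _).1 hex.choose_spec

/-! ### Vector-valued integrals -/

/-- By duality: the bounds on preimages give |⟨∫ Φ, x⟩| ≤ (∫ g) ‖B x‖, and Douglas factorization
produces a preimage of the integral. No measurable choice of preimages is needed. In the proof ∫ g +
1 replaces ∫ g so that one can divide by it. -/
theorem integral_mem_range_of_norm_le {H : Type*} [NormedAddCommGroup H] [InnerProductSpace ℂ H]
    [CompleteSpace H] {X : Type*} [MeasurableSpace X] {ν : Measure X} {B : H →L[ℂ] H}
    (hB : IsSelfAdjoint B) (hinj : Function.Injective B) {Φ : X → H} {g : X → ℝ}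
    (hg : Integrable g ν) (h : ∀ᵐ t ∂ν, ∃ v, B v = Φ t ∧ ‖v‖ ≤ g t) :
    ∫ t, Φ t ∂ν ∈ B.range := by
  by_cases hΦ : Integrable Φ ν
  swap
  · rw [integral_undef hΦ]
    exact zero_mem _
  set y := ∫ t, Φ t ∂ν
  set M : ℝ := ∫ t, g t ∂ν
  have hM : 0 ≤ M := integral_nonneg_of_ae (by
    filter_upwards [h] with t ⟨v, _, hv⟩
    exact (norm_nonneg v).trans hv)
  have bound (x : H) : ‖inner ℂ y x‖ ≤ (M + 1) * ‖B x‖ := by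
    rw [norm_inner_symm, ← integral_inner hΦ x]
    have : ‖∫ t, inner ℂ x (Φ t) ∂ν‖ ≤ ∫ t, g t * ‖B x‖ ∂ν := by
      refine norm_integral_le_of_norm_le (hg.mul_const _) ?_
      filter_upwards [h] with t ⟨v, hv, hvg⟩
      rw [← hv, ← ContinuousLinearMap.adjoint_inner_left, hB.adjoint_eq]
      refine (norm_inner_le_norm _ _).trans ?_
      rw [mul_comm]
      gcongr
    rw [integral_mul_const] at this
    refine this.trans ?_
    gcongr
    linarith
  have hM1 : 0 < M + 1 := by linarith
  obtain ⟨C, -, hC⟩ := exists_factor_of_norm_le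
    (A := innerSL ℂ ((((M + 1)⁻¹ : ℝ) : ℂ) • y)) hB hinj fun x => by
      rw [innerSL_apply_apply, inner_smul_left, norm_mul, Complex.conj_ofReal, Complex.norm_real,
        Real.norm_eq_abs, abs_of_pos (by positivity), inv_mul_le_iff₀ hM1]
      exact bound x
  have hy : ContinuousLinearMap.adjoint (innerSL ℂ ((((M + 1)⁻¹ : ℝ) : ℂ) • y)) 1 =
      (((M + 1)⁻¹ : ℝ) : ℂ) • y := by
    refine ext_inner_right ℂ fun x => ?_
    rw [ContinuousLinearMap.adjoint_inner_left, innerSL_apply_apply]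
    simp only [RCLike.inner_apply, map_one, mul_one]
  have : (((M + 1)⁻¹ : ℝ) : ℂ) • y ∈ B.range := ⟨C 1, by
    rw [← hy, hC]
    rfl⟩
  refine (Submodule.smul_mem_iff _ ?_).1 this
  exact_mod_cast (inv_pos.2 hM1).ne'

theorem setIntegral_norm_le (f : L2) {s : Set E3} (hμs : volume s ≠ ⊤) :
    ∫ x in s, ‖(f : E3 → ℂ) x‖ ≤ ‖f‖ * (volume s ^ (1 / 2 : ℝ)).toReal := by
  have hm := (Lp.aestronglyMeasurable f).mono_measure (Measure.restrict_le_self (s := s))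
  have h1 := eLpNorm_le_eLpNorm_mul_rpow_measure_univ (one_le_two : (1 : ENNReal) ≤ 2) hm
  have h2 : eLpNorm (f : E3 → ℂ) 2 (volume.restrict s) ≤ eLpNorm (f : E3 → ℂ) 2 volume :=
    eLpNorm_mono_measure _ Measure.restrict_le_self
  rw [integral_norm_eq_lintegral_enorm hm, ← eLpNorm_one_eq_lintegral_enorm, Lp.norm_def,
    ← ENNReal.toReal_mul]
  refine ENNReal.toReal_mono (ENNReal.mul_ne_top (Lp.eLpNorm_ne_top f)
    (ENNReal.rpow_ne_top_of_nonneg (by norm_num) hμs)) (h1.trans ?_)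
  rw [Measure.restrict_apply_univ]
  norm_num
  gcongr

/-- A Bochner integral in `L²` is given by the pointwise integral. -/
theorem integral_L2_ae_eq {ν : Measure ℝ} [SFinite ν] {Φ : ℝ → L2} {F : ℝ → E3 → ℂ}
    (hΦ : Integrable Φ ν) (hF : AEStronglyMeasurable (Function.uncurry F) (ν.prod volume))
    (h : ∀ᵐ t ∂ν, (Φ t : E3 → ℂ) =ᵐ[volume] F t) :
    ((∫ t, Φ t ∂ν : L2) : E3 → ℂ) =ᵐ[volume] fun x => ∫ t, F t x ∂ν := by
  have key (s : Set E3) (hμs : volume s ≠ ⊤) :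
      Integrable (Function.uncurry F) (ν.prod (volume.restrict s)) := by
    have hFs : AEStronglyMeasurable (Function.uncurry F) (ν.prod (volume.restrict s)) := by
      refine hF.mono_ac ?_
      exact Measure.AbsolutelyContinuous.prod .rfl Measure.restrict_le_self.absolutelyContinuous
    rw [integrable_prod_iff hFs]
    constructor
    · filter_upwards [h] with t ht
      exact (integrableOn_Lp_of_measure_ne_top (Φ t) one_le_two hμs).congr (ae_restrict_of_ae ht)
    · refine (hΦ.norm.mul_const ((volume s ^ (1 / 2 : ℝ)).toReal)).mono'
        hFs.norm.integral_prod_right' ?_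
      filter_upwards [h] with t ht
      rw [Real.norm_of_nonneg (integral_nonneg fun _ => norm_nonneg _)]
      refine le_trans (le_of_eq ?_) (setIntegral_norm_le (Φ t) hμs)
      refine integral_congr_ae (ae_restrict_of_ae ?_)
      filter_upwards [ht] with x hx
      rw [hx]
      rfl
  refine ae_eq_of_forall_setIntegral_eq_of_sigmaFinite
    (fun s _ hs => integrableOn_Lp_of_measure_ne_top _ one_le_two hs.ne)
    (fun s _ hs => (key s hs.ne).integral_prod_right) fun s hsm hs => ?_
  -- Integration over a set of finite measure is the inner product with its indicator, which
  -- commutes with the Bochner integral; Fubini handles the pointwise side.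
  rw [← L2.inner_indicatorConstLp_one hsm hs.ne, ← integral_inner hΦ,
    ← integral_integral_swap (key s hs.ne)]
  refine integral_congr_ae ?_
  filter_upwards [h] with t ht
  rw [L2.inner_indicatorConstLp_one hsm hs.ne]
  exact integral_congr_ae (ae_restrict_of_ae ht)

/-! ### Regularity of the Green function -/

theorem integrable_symbol_rpow {a s : ℝ} (ha : 0 < a) (hs : 3 / 2 < s) :
    Integrable fun ξ : E3 => symbol a ξ ^ (-s) := by
  have h := integrable_rpow_neg_one_add_norm_sq (E := E3) (μ := volume) (r := 2 * s) (by
    simp only [finrank_euclideanSpace, Fintype.card_fin]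
    push_cast
    linarith)
  set c : ℝ := 1 / a + 1 / (4 * Real.pi ^ 2)
  have hc : 0 < c := by positivity
  refine (h.const_mul (c ^ s)).mono' ((measurable_symbol a).pow_const _).aestronglyMeasurable
    (.of_forall fun ξ => ?_)
  have hp := symbol_pos ha ξ
  rw [Real.norm_of_nonneg (Real.rpow_nonneg hp.le _), show -(2 * s) / 2 = -s by ring]
  calc symbol a ξ ^ (-s) = c ^ s * (c * symbol a ξ) ^ (-s) := by
        rw [Real.mul_rpow hc.le hp.le, ← mul_assoc, ← Real.rpow_add hc]
        simp
    _ ≤ c ^ s * (1 + ‖ξ‖ ^ 2) ^ (-s) := by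
        refine mul_le_mul_of_nonneg_left ?_ (by positivity)
        exact Real.rpow_le_rpow_of_nonpos (by positivity) (le_symbol_mul ha ξ) (by linarith)

/-- The critical exponent in dimension three: in polar coordinates the integrand is of order r² r⁻³
= 1/r at infinity. -/
theorem not_integrable_symbol_rpow {a : ℝ} (ha : 0 < a) :
    ¬ Integrable fun ξ : E3 => symbol a ξ ^ (-(3 / 2) : ℝ) := by
  intro h
  have e : (fun ξ : E3 => symbol a ξ ^ (-(3 / 2) : ℝ)) =
      fun ξ => (fun r : ℝ => (4 * Real.pi ^ 2 * r ^ 2 + a) ^ (-(3 / 2) : ℝ)) ‖ξ‖ := rfl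
  rw [e, integrable_fun_norm_addHaar (volume : Measure E3)
    (f := fun r : ℝ => (4 * Real.pi ^ 2 * r ^ 2 + a) ^ (-(3 / 2) : ℝ))] at h
  simp only [finrank_euclideanSpace, Fintype.card_fin, smul_eq_mul] at h
  set c : ℝ := 4 * Real.pi ^ 2 + a
  have hc : 0 < c := by positivity
  refine not_integrableOn_Ioi_inv (a := 1) ?_
  have h1 := (h.mono_set (Ioi_subset_Ioi zero_le_one)).const_mul (c ^ (3 / 2 : ℝ))
  refine h1.mono' (by fun_prop) ?_
  filter_upwards [ae_restrict_mem measurableSet_Ioi] with r hr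
  have hr1 : 1 < r := hr
  have hr0 : 0 < r := by linarith
  rw [Real.norm_of_nonneg (by positivity)]
  have hle : 4 * Real.pi ^ 2 * r ^ 2 + a ≤ c * r ^ 2 := by
    have : a * 1 ≤ a * r ^ 2 := by gcongr; nlinarith
    simp only [c]
    linarith
  have h2 : (c * r ^ 2) ^ (-(3 / 2) : ℝ) ≤ (4 * Real.pi ^ 2 * r ^ 2 + a) ^ (-(3 / 2) : ℝ) :=
    Real.rpow_le_rpow_of_nonpos (by positivity) hle (by norm_num)
  calc r⁻¹ = c ^ (3 / 2 : ℝ) * (r ^ 2 * (c * r ^ 2) ^ (-(3 / 2) : ℝ)) := by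
        have e3 : (r ^ 2) ^ (-(3 / 2) : ℝ) = (r ^ 3)⁻¹ := by
          rw [← Real.rpow_natCast, ← Real.rpow_mul hr0.le, ← Real.rpow_natCast, ← Real.rpow_neg hr0.le]
          norm_num
        have hcp : c ^ (3 / 2 : ℝ) ≠ 0 := by positivity
        rw [Real.mul_rpow hc.le (by positivity), e3, Real.rpow_neg hc.le]
        field_simp
    _ ≤ _ := by
        simp only [Nat.add_one_sub_one]
        gcongr

theorem memLp_two_symbol_rpow_iff {a s : ℝ} (ha : 0 < a) :
    MemLp (fun ξ : E3 => ((symbol a ξ ^ (-s) : ℝ) : ℂ)) 2 volume ↔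
      Integrable fun ξ : E3 => symbol a ξ ^ (-(2 * s)) := by
  rw [memLp_two_iff_integrable_sq_norm
    (f := fun ξ : E3 => ((symbol a ξ ^ (-s) : ℝ) : ℂ))
    (Complex.measurable_ofReal.comp ((measurable_symbol a).pow_const _)).aestronglyMeasurable]
  refine iff_of_eq (congrArg (fun f : E3 → ℝ => Integrable f) (funext fun ξ => ?_))
  rw [Complex.norm_real, Real.norm_eq_abs, sq_abs, ← Real.rpow_natCast,
    ← Real.rpow_mul (symbol_pos ha ξ).le]
  ring_nf

/-- A preimage would have Fourier transform (|p|² + a)^{-3/4}, whose square is the critical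
function. -/
theorem greenVec_notMem_range {a : ℝ} (ha : 0 < a) : greenVec a ∉ (besselOp a (1 / 4)).range := by
  rintro ⟨v, hv⟩
  have h := (besselOp_eq_iff ha (by norm_num)).1 hv
  have : MemLp (fun ξ : E3 => ((symbol a ξ ^ (-(3 / 4) : ℝ) : ℝ) : ℂ)) 2 volume := by
    refine (Lp.memLp (𝓕 v : L2)).ae_eq ?_
    filter_upwards [h, fourier_greenVec ha] with ξ h1 h2
    have hp := Real.rpow_pos_of_pos (symbol_pos ha ξ) (-(1 / 4))
    have hpc : ((symbol a ξ ^ (-(1 / 4) : ℝ) : ℝ) : ℂ) ≠ 0 := by exact_mod_cast hp.ne'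
    refine mul_left_cancel₀ hpc ?_
    rw [← h1, h2, ← Complex.ofReal_mul, ← Real.rpow_add (symbol_pos ha ξ)]
    norm_num
  rw [memLp_two_symbol_rpow_iff ha] at this
  norm_num at this
  refine not_integrable_symbol_rpow ha ?_
  norm_num
  exact this

theorem norm_mulOp_le {m : E3 → ℝ} (hm : Measurable m) {C : ℝ} (h : ∀ x, |m x| ≤ C) (f : L2) :
    ‖mulOp m f‖ ≤ C * ‖f‖ := by
  refine Lp.norm_le_mul_norm_of_ae_le_mul ?_
  filter_upwards [mulOp_ae_eq (memLp_top_of_bound hm h) f] with x hx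
  rw [hx, norm_mul, Complex.norm_real, Real.norm_eq_abs]
  gcongr
  exact h x

/-- With q = |p|² + a, the transform q^{σ/2}/(q + t) of the preimage is the product of the fixed
function q^{-(1 - σ/2 - ε)} and of q^{1-ε}/(q + t) ≤ (a + t)^{-ε}. The choice of ε keeps the first
factor in L²: 2(1 - σ/2 - ε) = 7/4 - σ/2 exceeds 3/2 exactly when σ < 1/2. -/
theorem exists_besselOp_eq_greenVec {a σ : ℝ} (ha : 0 < a) (hσ : 0 ≤ σ) (hσ2 : σ < 1 / 2) :
    ∃ ε : ℝ, 0 < ε ∧ ∃ N : ℝ, ∀ t, 0 ≤ t → ∃ v, besselOp a (σ / 2) v = greenVec (a + t) ∧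
      ‖v‖ ≤ N * (a + t) ^ (-ε) := by
  set ε : ℝ := (1 / 2 - σ) / 4 with hε
  have hε0 : 0 < ε := by linarith
  have hmem : MemLp (fun ξ : E3 => ((symbol a ξ ^ (-(1 - σ / 2 - ε)) : ℝ) : ℂ)) 2 volume := by
    rw [memLp_two_symbol_rpow_iff ha]
    exact integrable_symbol_rpow ha (by linarith)
  refine ⟨ε, hε0, ‖hmem.toLp _‖, fun t ht => ?_⟩
  have hb : 0 < a + t := by linarith
  set m : E3 → ℝ := fun ξ => symbol a ξ ^ (1 - ε) * symbol (a + t) ξ ^ (-1 : ℝ)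
  have hmm : Measurable m :=
    ((measurable_symbol a).pow_const _).mul ((measurable_symbol (a + t)).pow_const _)
  have hmb (ξ : E3) : |m ξ| ≤ (a + t) ^ (-ε) := by
    have p1 := symbol_pos ha ξ
    have p2 := symbol_pos hb ξ
    have hle : symbol a ξ ≤ symbol (a + t) ξ := by
      have := symbol_sub (a + t) a ξ
      linarith
    rw [abs_of_nonneg (mul_nonneg (Real.rpow_nonneg p1.le _) (Real.rpow_nonneg p2.le _))]
    calc m ξ ≤ symbol (a + t) ξ ^ (1 - ε) * symbol (a + t) ξ ^ (-1 : ℝ) := by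
          refine mul_le_mul_of_nonneg_right ?_ (Real.rpow_nonneg p2.le _)
          exact Real.rpow_le_rpow p1.le hle (by linarith)
      _ = symbol (a + t) ξ ^ (-ε) := by
          rw [← Real.rpow_add p2]
          ring_nf
      _ ≤ (a + t) ^ (-ε) :=
          Real.rpow_le_rpow_of_nonpos hb (le_symbol (a + t) ξ) (by linarith)
  refine ⟨𝓕⁻ (mulOp m (hmem.toLp _)), ?_, ?_⟩
  · rw [besselOp_eq_iff ha (by linarith), FourierTransform.fourier_fourierInv_eq]
    filter_upwards [mulOp_ae_eq (memLp_top_of_bound hmm hmb) (hmem.toLp _), hmem.coeFn_toLp,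
      fourier_greenVec hb] with ξ h1 h2 h3
    rw [h1, h2, h3, ← Complex.ofReal_mul, ← Complex.ofReal_mul]
    congr 1
    have p1 := symbol_pos ha ξ
    simp only [m]
    rw [mul_right_comm, ← Real.rpow_add p1, ← mul_assoc, ← Real.rpow_add p1]
    ring_nf
    simp
  · have : ‖(𝓕⁻ (mulOp m (hmem.toLp _)) : L2)‖ = ‖mulOp m (hmem.toLp _)‖ :=
      (Lp.fourierTransformₗᵢ E3 ℂ).symm.norm_map _
    rw [this, mul_comm]
    exact norm_mulOp_le hmm hmb _

/-! ### Integrability of the weights -/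

theorem integrableOn_rpow_mul_rpow {a p : ℝ} (ha : 0 < a) (hp : 3 / 4 < p) :
    IntegrableOn (fun t : ℝ => t ^ (-(1 / 4) : ℝ) * (a + t) ^ (-p)) (Ioi 0) := by
  have hm : Measurable fun t : ℝ => t ^ (-(1 / 4) : ℝ) * (a + t) ^ (-p) := by fun_prop
  rw [← Ioc_union_Ioi_eq_Ioi zero_le_one]
  refine IntegrableOn.union ?_ ?_
  · have h1 : IntegrableOn (fun t : ℝ => t ^ (-(1 / 4) : ℝ)) (Ioc 0 1) :=
      (intervalIntegrable_iff_integrableOn_Ioc_of_le zero_le_one).1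
        (intervalIntegral.intervalIntegrable_rpow' (by norm_num))
    refine (h1.mul_const (a ^ (-p))).mono' hm.aestronglyMeasurable ?_
    filter_upwards [ae_restrict_mem measurableSet_Ioc] with t ht
    have ht0 : 0 < t := ht.1
    rw [Real.norm_of_nonneg (by positivity)]
    refine mul_le_mul_of_nonneg_left ?_ (by positivity)
    exact Real.rpow_le_rpow_of_nonpos ha (by linarith) (by linarith)
  · refine (integrableOn_Ioi_rpow_of_lt (by linarith : -(1 / 4) + -p < -1) zero_lt_one).mono'
      hm.aestronglyMeasurable ?_
    filter_upwards [ae_restrict_mem measurableSet_Ioi] with t ht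
    have ht0 : 0 < t := zero_lt_one.trans ht
    rw [Real.norm_of_nonneg (by positivity), Real.rpow_add ht0]
    refine mul_le_mul_of_nonneg_left ?_ (by positivity)
    exact Real.rpow_le_rpow_of_nonpos ht0 (by linarith) (by linarith)

/-! ### The singular part -/

/-- The resolvent `(-Δ_α + a)⁻¹`. -/
def pointResolvent (α a : ℝ) : L2 →L[ℂ] L2 := perturbed α (fun a => besselOp a 1) greenVec a

/-- The density of the singular part with respect to the Green functions `G_{a + t}`. -/
def density (α a : ℝ) (u : L2) (t : ℝ) : ℂ :=
  ((t ^ (-(1 / 4) : ℝ) * coupling α (a + t) : ℝ) : ℂ) * inner ℂ (greenVec (a + t)) u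

/-- The singular part of `(-Δ_α + a) ^ (-1/4) u`. -/
def singularVec (α a : ℝ) (u : L2) : L2 :=
  fourthRoot (pointResolvent α a) u - besselOp a (1 / 4) u

section

variable {α a : ℝ} (hα : 0 ≤ α) (ha : 0 < a)

include hα ha in
theorem singularVec_eq_integral (u : L2) :
    IntegrableOn (fun t => density α a u t • greenVec (a + t)) (Ioi 0) ∧
    ((√2 * Real.pi : ℝ) : ℂ) • singularVec α a u =
      ∫ t in Ioi (0 : ℝ), density α a u t • greenVec (a + t) := by
  have := isGreenFamily_greenVec.quarter_sub_eq_integral hα ha u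
  rw [singularVec, ← besselOp_quarter ha]
  exact this

include ha in
theorem norm_greenVec_le : ‖greenVec a‖ ≤ a ^ (-(1 / 4) : ℝ) := by
  rw [← sq_le_sq₀ (norm_nonneg _) (by positivity), isGreenFamily_greenVec.norm_sq ha,
    ← Real.rpow_natCast, ← Real.rpow_mul ha.le]
  have : a ^ (-(1 / 4) * (2 : ℕ) : ℝ) = (√a)⁻¹ := by
    rw [Real.sqrt_eq_rpow, ← Real.rpow_neg ha.le]
    norm_num
  rw [this, ← one_div]
  have := Real.sqrt_pos.2 ha
  refine one_div_le_one_div_of_le this ?_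
  nlinarith [Real.pi_gt_three]

include hα ha in
theorem coupling_eq : coupling α a = 4 * Real.pi / (4 * Real.pi * α + √a) := by
  have := Real.sqrt_pos.2 ha
  have h2 : α + √a / (4 * Real.pi) ≠ 0 := by positivity
  have h3 : 4 * Real.pi * α + √a ≠ 0 := by positivity
  rw [coupling]
  field_simp

include hα ha in
theorem coupling_le : coupling α a ≤ 4 * Real.pi * a ^ (-(1 / 2) : ℝ) := by
  have h := Real.sqrt_pos.2 ha
  rw [coupling_eq hα ha, Real.rpow_neg ha.le, ← Real.sqrt_eq_rpow, ← div_eq_mul_inv]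
  gcongr
  have : 0 ≤ 4 * Real.pi * α := by positivity
  linarith

include hα ha in
theorem norm_density_le (u : L2) {t : ℝ} (ht : 0 < t) :
    ‖density α a u t‖ ≤ 4 * Real.pi * ‖u‖ * (t ^ (-(1 / 4) : ℝ) * (a + t) ^ (-(3 / 4) : ℝ)) := by
  have hb : 0 < a + t := by linarith
  have hc := coupling_pos hα hb
  rw [density, norm_mul, Complex.norm_real, Real.norm_of_nonneg (by positivity)]
  have h1 : ‖inner ℂ (greenVec (a + t)) u‖ ≤ (a + t) ^ (-(1 / 4) : ℝ) * ‖u‖ :=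
    (norm_inner_le_norm _ _).trans (by gcongr; exact norm_greenVec_le hb)
  calc _ ≤ t ^ (-(1 / 4) : ℝ) * (4 * Real.pi * (a + t) ^ (-(1 / 2) : ℝ)) *
        ((a + t) ^ (-(1 / 4) : ℝ) * ‖u‖) := by
        gcongr
        exact coupling_le hα hb
    _ = _ := by
        have : (a + t) ^ (-(3 / 4) : ℝ) = (a + t) ^ (-(1 / 2) : ℝ) * (a + t) ^ (-(1 / 4) : ℝ) := by
          rw [← Real.rpow_add hb]
          norm_num
        rw [this]
        ring

include hα ha in
theorem singularVec_mem_sobolev (u : L2) {σ : ℝ} (hσ : 0 ≤ σ) (hσ2 : σ < 1 / 2) :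
    singularVec α a u ∈ sobolev σ := by
  obtain ⟨ε, hε, N, hN⟩ := exists_besselOp_eq_greenVec ha hσ hσ2
  have hc : ((√2 * Real.pi : ℝ) : ℂ) ≠ 0 := by
    exact_mod_cast (by positivity : (√2 * Real.pi : ℝ) ≠ 0)
  rw [sobolev_eq_range ha hσ, ← Submodule.smul_mem_iff _ hc, (singularVec_eq_integral hα ha u).2]
  -- The bound t^{-1/4} (a + t)^{-3/4} for the density just fails to be integrable at infinity; the
  -- factor (a + t)^{-ε} from the Green functions repairs this.
  have hg := (integrableOn_rpow_mul_rpow ha (by linarith : 3 / 4 < 3 / 4 + ε)).const_mul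
    (4 * Real.pi * ‖u‖ * N)
  refine integral_mem_range_of_norm_le
    (IsSelfAdjoint.of_nonneg (besselOp_nonneg ha (by linarith)))
    (besselOp_injective ha (by linarith)) hg ?_
  filter_upwards [ae_restrict_mem measurableSet_Ioi] with t ht
  have ht0 : 0 < t := ht
  obtain ⟨v, hv, hvN⟩ := hN t ht0.le
  refine ⟨density α a u t • v, by rw [map_smul, hv], ?_⟩
  rw [norm_smul]
  calc _ ≤ 4 * Real.pi * ‖u‖ * (t ^ (-(1 / 4) : ℝ) * (a + t) ^ (-(3 / 4) : ℝ)) *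
        (N * (a + t) ^ (-ε)) := by
        gcongr
        exact norm_density_le hα ha u ht0
    _ = _ := by
        rw [neg_add, Real.rpow_add (by linarith)]
        ring

include hα ha in
theorem singularVec_mem_sobolevMinus (u : L2) : singularVec α a u ∈ sobolevMinus (1 / 2) := by
  simp only [sobolevMinus, Submodule.mem_iInf, mem_Iio]
  intro σ hσ
  exact sobolev_mono (le_max_left σ 0) (singularVec_mem_sobolev hα ha u (le_max_right σ 0)
    (max_lt hσ (by norm_num)))

include hα ha in
-- Pairing the integrable L²-valued integrand with G_a gives the density times ⟨G_a, G_{a+t}⟩, an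
-- explicit nonzero function of t that can be divided out.
theorem aestronglyMeasurable_density (u : L2) :
    AEStronglyMeasurable (density α a u) (volume.restrict (Ioi 0)) := by
  have h1 := ((innerSL ℂ (greenVec a)).integrable_comp
    (singularVec_eq_integral hα ha u).1).aestronglyMeasurable
  have h2 : Measurable fun t : ℝ => ((4 * Real.pi * (√a + √(a + t)) : ℝ) : ℂ) := by fun_prop
  refine (h1.mul h2.aestronglyMeasurable).congr ?_
  filter_upwards [ae_restrict_mem measurableSet_Ioi] with t ht
  have ht0 : 0 < t := ht
  have hb : 0 < a + t := by linarith
  have hs : 0 < √a := Real.sqrt_pos.2 ha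
  have hp : (4 * Real.pi * (√a + √(a + t)) : ℝ) ≠ 0 := by positivity
  simp only [Pi.mul_apply, innerSL_apply_apply, inner_smul_right,
    isGreenFamily_greenVec.inner_eq a (a + t) ha hb]
  rw [mul_assoc, ← Complex.ofReal_mul, one_div_mul_cancel hp]
  simp

theorem measurable_green_prod (a : ℝ) :
    Measurable fun p : ℝ × E3 => green (a + p.1) p.2 := by
  unfold green
  fun_prop

include hα ha in
theorem singularIntegrand_eq (u : L2) (x : E3) {t : ℝ} (ht : 0 < t) :
    singularIntegrand α a (1 / 2) (besselOp a (1 / 4) u) x t =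
      ((1 / (4 * Real.pi) : ℝ) : ℂ) * (density α a u t * green (a + t) x) := by
  have hb : 0 < a + t := by linarith
  have hf : freePower a (1 / 2) (besselOp a (1 / 4) u) = u := by
    have := freePower_besselOp ha (by norm_num : (0 : ℝ) ≤ 1 / 2) u
    norm_num at this ⊢
    exact this
  have hs := Real.sqrt_pos.2 hb
  have hd : ((4 * Real.pi * α + √(a + t) : ℝ) : ℂ) ≠ 0 := by
    exact_mod_cast (by positivity : (4 * Real.pi * α + √(a + t) : ℝ) ≠ 0)
  have hpi : (Real.pi : ℂ) ≠ 0 := by exact_mod_cast Real.pi_ne_zero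
  rw [singularIntegrand, coeff, hf, ← inner_greenVec hb, density, coupling_eq hα hb,
    show (-(1 / 2 / 2) : ℝ) = -(1 / 4) by norm_num, Complex.ofReal_mul, Complex.ofReal_div]
  push_cast at hd ⊢
  field_simp

/-- Away from the origin e^{-y} ≤ 1/y suffices: the resulting decay b^{-1/2} makes the integral for
h_f(x) converge absolutely. -/
theorem norm_green_le {b : ℝ} (hb : 0 < b) {x : E3} (hx : x ≠ 0) :
    ‖green b x‖ ≤ 1 / (4 * Real.pi * ‖x‖ ^ 2) * b ^ (-(1 / 2) : ℝ) := by
  have hs := Real.sqrt_pos.2 hb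
  have hx0 : 0 < ‖x‖ := norm_pos_iff.2 hx
  rw [green, Complex.norm_real, Real.norm_of_nonneg (by positivity), Real.rpow_neg hb.le,
    ← Real.sqrt_eq_rpow]
  have h1 : Real.exp (-(√b * ‖x‖)) ≤ (√b * ‖x‖)⁻¹ := by
    rw [Real.exp_neg]
    have := Real.add_one_le_exp (√b * ‖x‖)
    gcongr
    linarith
  calc _ ≤ (√b * ‖x‖)⁻¹ / (4 * Real.pi * ‖x‖) := by gcongr
    _ = _ := by field_simp

include hα ha in
theorem integrableOn_singularIntegrand (u : L2) {x : E3} (hx : x ≠ 0) :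
    IntegrableOn (singularIntegrand α a (1 / 2) (besselOp a (1 / 4) u) x) (Ioi 0) := by
  have hx0 : 0 < ‖x‖ := norm_pos_iff.2 hx
  have h : IntegrableOn (fun t => density α a u t * green (a + t) x) (Ioi 0) := by
    refine ((integrableOn_rpow_mul_rpow ha (by norm_num : (3 / 4 : ℝ) < 5 / 4)).const_mul
      (4 * Real.pi * ‖u‖ * (1 / (4 * Real.pi * ‖x‖ ^ 2)))).mono' ?_ ?_
    · exact (aestronglyMeasurable_density hα ha u).mul
        ((measurable_green_prod a).comp measurable_prodMk_right).aestronglyMeasurable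
    · filter_upwards [ae_restrict_mem measurableSet_Ioi] with t ht
      have ht0 : 0 < t := ht
      have hb : 0 < a + t := by linarith
      rw [norm_mul]
      calc _ ≤ 4 * Real.pi * ‖u‖ * (t ^ (-(1 / 4) : ℝ) * (a + t) ^ (-(3 / 4) : ℝ)) *
            (1 / (4 * Real.pi * ‖x‖ ^ 2) * (a + t) ^ (-(1 / 2) : ℝ)) :=
            mul_le_mul (norm_density_le hα ha u ht0) (norm_green_le hb hx) (norm_nonneg _)
              (by positivity)
        _ = _ := by
            have : (a + t) ^ (-(5 / 4) : ℝ) =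
                (a + t) ^ (-(3 / 4) : ℝ) * (a + t) ^ (-(1 / 2) : ℝ) := by
              rw [← Real.rpow_add hb]
              norm_num
            rw [this]
            ring
  refine IntegrableOn.congr_fun (h.const_mul _)
    (fun t ht => (singularIntegrand_eq hα ha u x ht).symm) measurableSet_Ioi

include hα ha in
theorem singularVec_ae_eq (u : L2) : (singularVec α a u : E3 → ℂ) =ᵐ[volume]
    singularPart α a (1 / 2) (besselOp a (1 / 4) u) := by
  obtain ⟨hi, he⟩ := singularVec_eq_integral hα ha u
  have h := integral_L2_ae_eq (F := fun t x => density α a u t * green (a + t) x) hi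
    ((aestronglyMeasurable_density hα ha u).comp_fst.mul
      (measurable_green_prod a).aestronglyMeasurable) (by
    filter_upwards [ae_restrict_mem measurableSet_Ioi] with t ht
    have ht0 : 0 < t := ht
    have hb : 0 < a + t := by linarith
    filter_upwards [Lp.coeFn_smul (density α a u t) (greenVec (a + t)), greenVec_ae_eq hb]
      with x h1 h2
    rw [h1, Pi.smul_apply, h2, smul_eq_mul])
  rw [← he] at h
  filter_upwards [h, Lp.coeFn_smul ((√2 * Real.pi : ℝ) : ℂ) (singularVec α a u)] with x h1 h2
  rw [h2, Pi.smul_apply, smul_eq_mul] at h1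
  rw [singularPart, setIntegral_congr_fun measurableSet_Ioi
    (fun t ht => singularIntegrand_eq hα ha u x ht), integral_const_mul, ← h1,
    ← mul_assoc, ← mul_assoc, ← Complex.ofReal_mul, ← Complex.ofReal_mul,
    show (1 / 2 * Real.pi / 2 : ℝ) = Real.pi / 4 by ring, Real.sin_pi_div_four]
  have h22 : √2 * √2 = 2 := Real.mul_self_sqrt (by norm_num)
  -- The normalization 4 sin(π/4) of h_f cancels 1/(4π) from the coupling and √2 π from
  -- Balakrishnan's formula.
  have : 4 * (√2 / 2) * (1 / (4 * Real.pi)) * (√2 * Real.pi) = 1 := by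
    field_simp
    linear_combination h22
  rw [this]
  simp

end

/-! ### The resolvent of the point interaction Hamiltonian -/

theorem neg_laplacian_add_eq_fourierMultiplierCLM (a : ℝ) (T : 𝓢'(E3, ℂ)) :
    -Δ T + (a : ℂ) • T =
      TemperedDistribution.fourierMultiplierCLM ℂ (fun ξ => (symbol a ξ : ℂ)) T := by
  have h1 : (fun ξ : E3 => Complex.ofReal (‖ξ‖ ^ 2)).HasTemperateGrowth := by fun_prop
  have h2 : (fun _ : E3 => (a : ℂ)).HasTemperateGrowth := by fun_prop
  have h3 : (((2 * Real.pi) ^ 2 : ℝ) : ℂ) • (fun ξ : E3 => Complex.ofReal (‖ξ‖ ^ 2)) =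
      fun ξ : E3 => (((2 * Real.pi) ^ 2 * ‖ξ‖ ^ 2 : ℝ) : ℂ) := by
    funext ξ
    simp
  have e : (fun ξ : E3 => (symbol a ξ : ℂ)) =
      (((2 * Real.pi) ^ 2 : ℝ) : ℂ) • (fun ξ : E3 => Complex.ofReal (‖ξ‖ ^ 2)) +
        fun _ => (a : ℂ) := by
    funext ξ
    simp only [symbol, Pi.add_apply, Pi.smul_apply, smul_eq_mul]
    push_cast
    ring
  rw [e, TemperedDistribution.fourierMultiplierCLM_apply,
    TemperedDistribution.smulLeftCLM_add (by rw [h3]; fun_prop) h2,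
    TemperedDistribution.smulLeftCLM_smul h1, add_apply, smul_apply,
    TemperedDistribution.smulLeftCLM_const, FourierTransform.fourierInv_add,
    FourierTransform.fourierInv_smul, FourierTransform.fourierInv_smul,
    FourierTransform.fourierInv_fourier_eq,
    TemperedDistribution.laplacian_eq_fourierMultiplierCLM,
    TemperedDistribution.fourierMultiplierCLM_apply, neg_smul, neg_neg, Complex.coe_smul]

section

variable {a : ℝ} (ha : 0 < a)
include ha

theorem toDist_eq_neg_laplacian_add_iff (f w : L2) :
    toDist w = -Δ (toDist f) + (a : ℂ) • toDist f ↔ besselOp a 1 w = f := by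
  have hs : (fun ξ : E3 => (symbol a ξ : ℂ)).HasTemperateGrowth := by
    have := hasTemperateGrowth_symbol_rpow ha 1
    simpa using this
  rw [neg_laplacian_add_eq_fourierMultiplierCLM, toDist_eq_fourierMultiplierCLM_iff hs,
    besselOp_eq_iff ha zero_le_one]
  refine Filter.eventually_congr (.of_forall fun ξ => ?_)
  have hp : (symbol a ξ : ℂ) ≠ 0 := by exact_mod_cast (symbol_pos ha ξ).ne'
  simp only [Real.rpow_neg_one, Complex.ofReal_inv]
  rw [eq_inv_mul_iff_mul_eq₀ hp]
  exact eq_comm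

/-- The transform of (-Δ + a)⁻¹ w is a product of two L² functions, hence integrable, so Fourier
inversion gives a continuous representative. Its value at 0 is the integral of that product, which
is ⟨G_a, w⟩ by Plancherel. -/
theorem exists_continuous_besselOp_one (w : L2) : ∃ φ : E3 → ℂ, Continuous φ ∧
    (besselOp a 1 w : E3 → ℂ) =ᵐ[volume] φ ∧ φ 0 = inner ℂ (greenVec a) w := by
  set f := besselOp a 1 w
  have hint : Integrable (𝓕 f : L2) := by
    have h1 : MemLp (fun ξ : E3 => ((symbol a ξ ^ (-1 : ℝ) : ℝ) : ℂ)) 2 volume :=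
      (Lp.memLp (𝓕 (greenVec a) : L2)).ae_eq (fourier_greenVec ha)
    exact (h1.integrable_mul (Lp.memLp (𝓕 w : L2))).congr
      (fourier_besselOp ha zero_le_one w).symm
  refine ⟨𝓕⁻ ((𝓕 f : L2) : E3 → ℂ), continuous_fourierInv_of_integrable hint, ?_, ?_⟩
  · have := fourierInv_toLp_ae_eq hint (Lp.memLp (𝓕 f : L2))
    rwa [Lp.toLp_coeFn, FourierTransform.fourierInv_fourier_eq] at this
  · rw [← Lp.inner_fourier_eq, inner_eq_integral, Real.fourierInv_eq]
    refine integral_congr_ae ?_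
    filter_upwards [fourier_besselOp ha zero_le_one w, fourier_greenVec ha] with ξ h1 h2
    rw [h1, h2, Complex.conj_ofReal]
    simp

theorem pointResolvent_ae_eq (α : ℝ) (w : L2) {φ : E3 → ℂ}
    (hφ : (besselOp a 1 w : E3 → ℂ) =ᵐ[volume] φ) (h0 : φ 0 = inner ℂ (greenVec a) w) :
    (pointResolvent α a w : E3 → ℂ) =ᵐ[volume]
      fun x => φ x + φ 0 / ((α + Real.sqrt a / (4 * Real.pi) : ℝ) : ℂ) * green a x := by
  have e : pointResolvent α a w = besselOp a 1 w +
      ((coupling α a : ℂ) * inner ℂ (greenVec a) w) • greenVec a := perturbed_apply _ _ _ _ _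
  rw [e]
  refine (Lp.coeFn_add _ _).trans ?_
  filter_upwards [hφ, greenVec_ae_eq ha,
    Lp.coeFn_smul ((coupling α a : ℂ) * inner ℂ (greenVec a) w) (greenVec a)] with x h1 h2 h3
  rw [Pi.add_apply, h1, h3, Pi.smul_apply, h2, h0, smul_eq_mul, coupling, Complex.ofReal_inv]
  ring

/-- For w = v + a g the regular part f can only be (-Δ + a)⁻¹ w, and f(0) = ⟨G_a, w⟩. The defining
formula for g is then Krein's formula. -/
theorem mem_hamiltonianGraph_iff (α : ℝ) (p : L2 × L2) :
    p ∈ hamiltonianGraph α a ↔ pointResolvent α a (p.2 + (a : ℂ) • p.1) = p.1 := by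
  set w := p.2 + (a : ℂ) • p.1
  obtain ⟨ψ, hψc, hψ, hψ0⟩ := exists_continuous_besselOp_one ha w
  have hR := pointResolvent_ae_eq ha α w hψ hψ0
  constructor
  · rintro ⟨f, -, φ, hφc, hφ, hg, hd⟩
    have hf : besselOp a 1 w = f := (toDist_eq_neg_laplacian_add_iff ha f w).1 hd
    have : φ = ψ := by
      refine (Continuous.ae_eq_iff_eq volume hφc hψc).1 ?_
      rw [hf] at hψ
      exact hφ.symm.trans hψ
    subst this
    exact Lp.ext (hR.trans hg.symm)
  · intro h
    refine ⟨besselOp a 1 w, ?_, ψ, hψc, hψ, ?_, ?_⟩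
    · rw [sobolev_eq_range ha zero_le_two]
      exact ⟨w, by norm_num⟩
    · rw [← h]
      exact hR
    · exact (toDist_eq_neg_laplacian_add_iff ha _ w).2 rfl

end

theorem isResolventFamily_pointResolvent {α : ℝ} (hα : 0 ≤ α) :
    IsResolventFamily (pointResolvent α) :=
  isGreenFamily_greenVec.isResolventFamily_perturbed hα

/-- The operator whose resolvents are the S_a does not depend on a. This passes from the reference
value μ to 1. -/
theorem IsResolventFamily.apply_add_smul_eq {H : Type*} [NormedAddCommGroup H]
    [InnerProductSpace ℂ H] [CompleteSpace H] {S : ℝ → H →L[ℂ] H} (hS : IsResolventFamily S)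
    {a b : ℝ} (ha : 0 < a) (hb : 0 < b) {y v : H} (h : S a (v + (a : ℂ) • y) = y) :
    S b (v + (b : ℂ) • y) = y := by
  have h1 := congrArg (fun A : H →L[ℂ] H => A (v + (a : ℂ) • y)) (hS.sub_eq b a hb ha)
  simp only [sub_apply, smul_apply, mul_apply_eq_comp, h] at h1
  rw [← Complex.coe_smul, sub_eq_iff_eq_add, map_add, map_smul] at h1
  rw [map_add, map_smul]
  calc S b v + (b : ℂ) • S b y
      = S b v + (a : ℂ) • S b y + ((b : ℂ) - a) • S b y := by module
    _ = y := by
      rw [h1]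
      push_cast
      module

theorem isUnitResolvent_hamiltonian {α μ : ℝ} (hα : 0 ≤ α) (hμ : 0 < μ) :
    IsUnitResolvent (hamiltonian α μ) (pointResolvent α 1) := by
  have hS := isResolventFamily_pointResolvent hα
  have hgraph (p : L2 × L2) : p ∈ hamiltonianGraph α μ ↔ pointResolvent α 1 (p.2 + p.1) = p.1 := by
    rw [mem_hamiltonianGraph_iff hμ]
    constructor
    · intro h
      simpa using hS.apply_add_smul_eq hμ one_pos h
    · intro h
      refine hS.apply_add_smul_eq one_pos hμ ?_
      simpa using h
  -- Single-valuedness, without which `Submodule.toLinearPMap` need not have the given submodule as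
  -- its graph.
  have hsv (p : L2 × L2) (hp : p ∈ hamiltonianGraph α μ) (h0 : p.1 = 0) : p.2 = 0 := by
    rw [hgraph, h0, add_zero] at hp
    exact hS.injective 1 one_pos (hp.trans (map_zero _).symm)
  have hg : (hamiltonian α μ).graph = hamiltonianGraph α μ :=
    Submodule.toLinearPMap_graph_eq _ hsv
  refine ⟨hS.nonneg 1 one_pos, hS.one_le, fun x => ?_, fun y => ?_⟩
  · have hx : (pointResolvent α 1 x, x - pointResolvent α 1 x) ∈ (hamiltonian α μ).graph := by
      rw [hg, hgraph]
      simp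
    obtain ⟨y, hy1, hy2⟩ := (LinearPMap.mem_graph_iff _).1 hx
    have hd : pointResolvent α 1 x ∈ (hamiltonian α μ).domain := by
      have := y.2
      rwa [hy1] at this
    refine ⟨hd, ?_⟩
    have : y = ⟨pointResolvent α 1 x, hd⟩ := Subtype.ext hy1
    rw [← this, hy2]
    simp
  · have := (hamiltonian α μ).mem_graph y
    rw [hg, hgraph] at this
    exact this

theorem domain_fractionalPower_hamiltonian {α μ lam : ℝ} (hα : 0 ≤ α) (hμ : 0 < μ)
    (hlam : 0 < lam) : (fractionalPower (hamiltonian α μ) (1 / 4)).domain =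
      (fourthRoot (pointResolvent α lam)).range :=
  (domain_fractionalPower (isUnitResolvent_hamiltonian hα hμ) (by norm_num)).trans
    ((isResolventFamily_pointResolvent hα).range_quarter_eq one_pos hlam)

end PointInteraction

end

/-! ### The transition case s = 1/2. -/

open PointInteraction in
theorem mainTheorem5 (α lam μ : ℝ) (hα : 0 ≤ α) (hlam : 0 < lam) (hμ : 0 < μ) :
    -- for every `f` in `H^{1/2}`, the function `h_f` is well defined and belongs to `H^{1/2-}`
    (∀ f ∈ sobolev (1 / 2),
      (∀ x : E3, x ≠ 0 → IntegrableOn (singularIntegrand α lam (1 / 2) f x) (Set.Ioi 0)) ∧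
      ∃ h ∈ sobolevMinus (1 / 2),
        (h : E3 → ℂ) =ᵐ[volume] singularPart α lam (1 / 2) f) ∧
    -- the domain of `(-Δ_α)^{1/4}` is the set of all `f + h_f` with `f` in `H^{1/2}`
    ((fractionalPower (hamiltonian α μ) (1 / 4)).domain : Set L2) =
      {g : L2 | ∃ f ∈ sobolev (1 / 2),
        (g : E3 → ℂ) =ᵐ[volume] fun x => f x + singularPart α lam (1 / 2) f x} ∧
    -- the sum of `H^{1/2}` and `span {G_lam}` is direct
    Disjoint (sobolev (1 / 2)) (Submodule.span ℂ {greenL2 hlam}) ∧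
    -- it is strictly contained in the domain
    sobolev (1 / 2) ⊔ Submodule.span ℂ {greenL2 hlam} <
      (fractionalPower (hamiltonian α μ) (1 / 4)).domain ∧
    -- and the domain is contained in `H^{1/2-}`
    (fractionalPower (hamiltonian α μ) (1 / 4)).domain ≤ sobolevMinus (1 / 2) := by
  have hsob : sobolev (1 / 2) = (besselOp lam (1 / 4)).range := by
    rw [sobolev_eq_range hlam (by norm_num)]
    norm_num
  have hdom := domain_fractionalPower_hamiltonian (μ := μ) hα hμ hlam
  -- The same u parametrizes the domain and H^{1/2}: f is the free fourth root applied to u, and h_f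
  -- is the rest.
  have hsplit (u : L2) : fourthRoot (pointResolvent α lam) u =
      besselOp lam (1 / 4) u + singularVec α lam u := by
    rw [singularVec, add_sub_cancel]
  have hsum (u : L2) : (fourthRoot (pointResolvent α lam) u : E3 → ℂ) =ᵐ[volume]
      fun x => (besselOp lam (1 / 4) u : E3 → ℂ) x +
        singularPart α lam (1 / 2) (besselOp lam (1 / 4) u) x := by
    rw [hsplit]
    refine (Lp.coeFn_add _ _).trans ?_
    filter_upwards [singularVec_ae_eq hα hlam u] with x hx
    rw [Pi.add_apply, hx]
  have hG := greenVec_notMem_range hlam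
  rw [hsob, hdom, ← greenVec_eq hlam]
  refine ⟨?_, ?_, ?_, ?_, ?_⟩
  · rintro _ ⟨u, rfl⟩
    exact ⟨fun x hx => integrableOn_singularIntegrand hα hlam u hx,
      singularVec α lam u, singularVec_mem_sobolevMinus hα hlam u, singularVec_ae_eq hα hlam u⟩
  · ext g
    constructor
    · rintro ⟨u, rfl⟩
      exact ⟨besselOp lam (1 / 4) u, ⟨u, rfl⟩, hsum u⟩
    · rintro ⟨_, ⟨u, rfl⟩, hg⟩
      exact ⟨u, Lp.ext ((hsum u).trans hg.symm)⟩
  · exact (Submodule.disjoint_span_singleton' fun h0 : greenVec lam = 0 =>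
      hG (by rw [h0]; exact zero_mem _)).2 hG
  · rw [← besselOp_quarter hlam] at hG ⊢
    exact isGreenFamily_greenVec.sup_span_lt hα hlam hG
  · rintro _ ⟨u, rfl⟩
    refine (hsplit u).symm ▸ add_mem ?_ (singularVec_mem_sobolevMinus hα hlam u)
    simp only [sobolevMinus, Submodule.mem_iInf, mem_Iio]
    intro σ hσ
    exact sobolev_mono hσ.le (hsob ▸ ⟨u, rfl⟩)
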